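/- **Model.** For $m\ge 2$, the symmetric $m$-user binary deterministic random access channel (BD-RAC) has inputs $X_{i,t}\in\{0,1\}$ and, when $A\subseteq\{1,\dots,m\}$ is the set of active users, output $Y_{A,t}=\sum_{i\in A}X_{i,t}$ over $\mathrm{GF}(2)$, without noise. The receiver knows $A$; an encoder knows only its own messages. A message structure $\mathscr W$ gives each user $i$ finitely many independent messages $W_{i,1},W_{i,2},\dots$, where $W_{i,j}$ is uniform on a set of $2^{nR_{i,j}}$ elements (rounded up to an integer; $n$ is the block length and $R_{i,j}\ge 0$), and, for all $i\in A$, a subset $\mathcal W_i(A)$ of user $i$'s messages that must be decoded in state $A$, with $\mathcal W_i(B)\subseteq\mathcal W_i(A)$ for $i\in A\subseteq B$. Put $r_i(A)=\sum_{j:\,W_{i,j}\in\mathcal W_i(A)}R_{i,j}$. A tuple $(r_i(A))_{i\in A}$ is achievable for $\mathscr W$ if it arises in this way from rates for which there are codes of all block lengths $n$ (an encoder for each user and a decoder for each nonempty state $A$) whose average error probability tends to $0$ at every decoder as $n\to\infty$. Let $\mathcal C_{\mathscr W}$ be the closure of the set of tuples achievable for $\mathscr W$, and let $\mathcal C=\overline{\bigcup_{\mathscr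 W}\mathcal C_{\mathscr W}}$ be the capacity region. If every user is active with probability $p$, independently of the others, the expected sum-rate of $r$ is $\sum_{A}p^{|A|}(1-p)^{m-|A|}\sum_{i\in A}r_i(A)$, and the throughput $T(p,m)$ is its maximum over $\mathcal C$. **Statement.** For $m\ge 2$ and $p\in[0,1]$ the maximum that defines $T(p,m)$ is attained. Let $\Gamma(s,x)=\int_x^\infty t^{s-1}e^{-t}\,dt$. Put $\lambda_0=0$. For every integer $k\ge1$ the equation $$\frac1{k+1}\,\Gamma(k+1,\lambda)=\Gamma(k,\lambda)$$ has a unique solution $\lambda_k$ in $(0,\infty)$. The sequence $(\lambda_k)$ is strictly increasing and tends to $\infty$, so the intervals $(\lambda_{k-1},\lambda_k]$, $k\ge1$, partition $(0,\infty)$. For every $\lambda>0$ the limit $T(\lambda)=\lim_{m\to\infty}T(\lambda/m,m)$ exists, and $$T(\lambda)=\frac{\lambda}{k!}\,\Gamma(k,\lambda)\qquad\text{if }\lambda\in(\lambda_{k-1},\lambda_k],\ k\ge1.$$ For $\lambda\in(\lambda_{k-1},\lambda_k]$ the throughput is attained with a single message per user encoded at rate $\frac1k$: for every $m\ge2$ the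 tuple with $r_i(A)=\frac1k$ if $|A|\le k$ and $r_i(A)=0$ otherwise belongs to $\mathcal C_{\mathscr W}$ for the message structure $\mathscr W$ in which each user has one message, decoded exactly when at most $k$ users are active; and its expected sum-rate for $p=\lambda/m$ tends to $T(\lambda)$ as $m\to\infty$. Finally, $T$ is continuous on $(0,\infty)$, it is concave and strictly increasing on each interval $(\lambda_{k-1},\lambda_k]$, and $\lim_{\lambda\to\infty}T(\lambda)=1$. -/

import Mathlib

open Filter Topology Set
open scoped Nat

namespace RandomAccess

/-- A message structure for the `m`-user random access channel: user `i` has `num i` messages, and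
`decoded A i` is the set of those messages of the active user `i ∈ A` that are decoded when `A` is
the set of active users. Whatever is decoded when more users are active is decoded when fewer
are. -/
structure MessageStructure (m : ℕ) where
  num : Fin m → ℕ
  decoded : (A : Finset (Fin m)) → (i : A) → Finset (Fin (num i))
  decoded_anti : ∀ (A B : Finset (Fin m)) (h : A ⊆ B) (i : A),
    decoded B ⟨i, h i.2⟩ ⊆ decoded A i

/-- The number of values of a message of rate `R` (in bits per channel use) at block length `n`:
`2 ^ (n R)`, rounded up to an integer. -/
noncomputable def messageCard (n : ℕ) (R : ℝ) : ℕ := ⌈(2 : ℝ) ^ ((n : ℝ) * R)⌉₊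

/-- The coding rates of the individual messages. -/
abbrev MessageStructure.Rates {m : ℕ} (W : MessageStructure m) : Type :=
  (i : Fin m) → Fin (W.num i) → ℝ

/-- The values taken by all the messages of user `i`. -/
abbrev UserMessages {m : ℕ} (W : MessageStructure m) (R : W.Rates) (n : ℕ) (i : Fin m) : Type :=
  (j : Fin (W.num i)) → Fin (messageCard n (R i j))

/-- The values taken by all the messages of all users. -/
abbrev Messages {m : ℕ} (W : MessageStructure m) (R : W.Rates) (n : ℕ) : Type :=
  (i : Fin m) → UserMessages W R n i

/-- A code of block length `n` for binary inputs and outputs. Encoder `i` sees only the messages of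
user `i`; there is one decoder for each set `A` of active users. -/
structure Code {m : ℕ} (W : MessageStructure m) (R : W.Rates) (n : ℕ) where
  encode : (i : Fin m) → UserMessages W R n i → (Fin n → ZMod 2)
  decode : (A : Finset (Fin m)) → (Fin n → ZMod 2) →
    (i : A) → (j : W.decoded A i) → Fin (messageCard n (R i j))

/-- The output of the noiseless binary additive channel when `A` is the set of active users: the
sum over GF(2) of the codewords of the active users. -/
def Code.output {m : ℕ} {W : MessageStructure m} {R : W.Rates} {n : ℕ} (c : Code W R n)
    (A : Finset (Fin m)) (w : Messages W R n) : Fin n → ZMod 2 :=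
  ∑ i ∈ A, c.encode i (w i)

open Classical in
/-- Average probability of error at the decoder for the set `A` of active users: the probability,
for independent uniformly distributed messages, that some message which this decoder has to
decode is decoded wrongly. -/
noncomputable def Code.errorProb {m : ℕ} {W : MessageStructure m} {R : W.Rates} {n : ℕ}
    (c : Code W R n) (A : Finset (Fin m)) : ℝ :=
  ((Finset.univ.filter fun w : Messages W R n =>
      ∃ (i : A) (j : W.decoded A i), c.decode A (c.output A w) i j ≠ w i j).card : ℝ) /
    (Fintype.card (Messages W R n) : ℝ)

/-- A rate tuple `(r_i(A))`, indexed by the sets `A` of users and the users `i ∈ A`. -/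
abbrev RateTuple (m : ℕ) : Type := (A : Finset (Fin m)) → A → ℝ

/-- The tuple `r` is achievable for the message structure `W`: for some nonnegative message rates
`R`, `r_i(A)` is the total rate of the messages of user `i` decoded in state `A`, and there are
codes of all block lengths whose error probability tends to `0` at every decoder. -/
def Achievable {m : ℕ} (W : MessageStructure m) (r : RateTuple m) : Prop :=
  ∃ R : W.Rates, (∀ i j, 0 ≤ R i j) ∧
    (∀ (A : Finset (Fin m)) (i : A), r A i = ∑ j ∈ W.decoded A i, R i j) ∧
    ∃ c : (n : ℕ) → Code W R n, ∀ A : Finset (Fin m), A.Nonempty →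
      Tendsto (fun n => (c n).errorProb A) atTop (𝓝 0)

/-- The capacity region for a given message structure. -/
def capacityRegionOf {m : ℕ} (W : MessageStructure m) : Set (RateTuple m) :=
  closure {r | Achievable W r}

/-- The capacity region of the symmetric `m`-user binary additive random access channel. -/
def capacityRegion (m : ℕ) : Set (RateTuple m) :=
  closure (⋃ W : MessageStructure m, capacityRegionOf W)

/-- The expected sum-rate of `r` when each of the `m` users is active with probability `p`,
independently of the others. -/
noncomputable def expectedSumRate (m : ℕ) (p : ℝ) (r : RateTuple m) : ℝ :=
  ∑ A : Finset (Fin m), p ^ A.card * (1 - p) ^ (m - A.card) * ∑ i : A, r A i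

/-- The throughput: the largest expected sum-rate over the capacity region. -/
noncomputable def throughput (m : ℕ) (p : ℝ) : ℝ :=
  sSup (expectedSumRate m p '' capacityRegion m)

/-- The message structure with a single message per user, decoded when at most `k` users are
active. -/
def singleMessage (m k : ℕ) : MessageStructure m where
  num _ := 1
  decoded A _ := if A.card ≤ k then Finset.univ else ∅
  decoded_anti A B h _ := by
    by_cases hB : B.card ≤ k
    · simp [hB, (Finset.card_le_card h).trans hB]
    · simp [hB]

/-- The rate tuple in which every active user sends its single message at rate `1 / k` and the
message is decoded when at most `k` users are active. -/
noncomputable def singleMessageTuple (m k : ℕ) : RateTuple m :=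
  fun A _ => if A.card ≤ k then 1 / (k : ℝ) else 0

/-- The (upper) incomplete gamma function `Γ(s, x)`. -/
noncomputable def incompleteGamma (s x : ℝ) : ℝ :=
  ∫ t in Ioi x, t ^ (s - 1) * Real.exp (-t)

end RandomAccess

namespace RandomAccess

/-! ### Partial sums of the exponential series -/

/-! Converse. If the users of a set become active one at a time, the receiver can undo the process:
in state `A` it decodes the newest user's messages for that state, and with that user's codeword
fixed the output is a translate of the output of the remaining users. Different decoded values give
disjoint translates, so the numbers of decoded values along a chain multiply to at most a constant
times `2 ^ n`. Errors cost a factor 2 per step (`chainProd_le_card_image`). Hence the rates along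
every chain sum to at most 1.

Averaging over all sets of size `j` turns this into a nonnegative, nonincreasing sequence `x_1, ...,
x_m` with sum at most 1 (`levelAverage_succ_le`, `sum_levelAverage_le`), and the expected sum-rate
is linear in it. The nonzero extreme sequences are `(1/k, ..., 1/k, 0, ..., 0)`, so the best value
is the largest `singleRate` (`expectedSumRate_le`).

Achievability. User `i` sends a symbol of `GF(2^L)` repeated `k` times with weights `α_i ^ s`. A
Vandermonde system with distinct nodes recovers up to `k` active users without error
(`exists_encoders`), at any rate below `1/k`.

Limit. For `p = λ/m` the value of `k` tends to `(λ/k) P(Poisson(λ) < k)`, and large `k` are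
negligible uniformly in `m`. One function, `breakFun k`, decides both whether `k + 1` beats `k` and
the sign of the derivative of the `k`-th value. Its single sign change gives the breakpoints, the
monotonicity and the concavity. -/

/-- The sum of the first `k` terms of the exponential series. -/
noncomputable def expSum (k : ℕ) (x : ℝ) : ℝ := ∑ j ∈ Finset.range k, x ^ j / (j ! : ℝ)

theorem expSum_succ (k : ℕ) (x : ℝ) : expSum (k + 1) x = expSum k x + x ^ k / (k ! : ℝ) :=
  Finset.sum_range_succ _ _

theorem one_le_expSum {k : ℕ} (hk : 1 ≤ k) {x : ℝ} (hx : 0 ≤ x) : 1 ≤ expSum k x := by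
  obtain ⟨k, rfl⟩ := Nat.exists_eq_add_of_le' hk
  rw [expSum, Finset.sum_range_succ']
  have : 0 ≤ ∑ j ∈ Finset.range k, x ^ (j + 1) / ((j + 1)! : ℝ) :=
    Finset.sum_nonneg fun _ _ => by positivity
  simpa using this

theorem expSum_le_exp (k : ℕ) {x : ℝ} (hx : 0 ≤ x) : expSum k x ≤ Real.exp x :=
  Real.sum_le_exp_of_nonneg hx k

theorem pow_succ_div_factorial_succ (k : ℕ) (x : ℝ) :
    ((k : ℝ) + 1) * (x ^ (k + 1) / ((k + 1)! : ℝ)) = x * (x ^ k / (k ! : ℝ)) := by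
  have : (k ! : ℝ) ≠ 0 := by positivity
  rw [Nat.factorial_succ]
  push_cast
  field_simp
  ring

theorem hasDerivAt_pow_succ_div_factorial (k : ℕ) (x : ℝ) :
    HasDerivAt (fun x : ℝ => x ^ (k + 1) / ((k + 1)! : ℝ)) (x ^ k / (k ! : ℝ)) x := by
  refine ((hasDerivAt_pow (k + 1) x).div_const ((k + 1)! : ℝ)).congr_deriv ?_
  have : (k ! : ℝ) ≠ 0 := by positivity
  rw [Nat.factorial_succ]
  push_cast
  field_simp

theorem hasDerivAt_expSum_succ (k : ℕ) (x : ℝ) :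
    HasDerivAt (expSum (k + 1)) (expSum k x) x := by
  induction k with
  | zero =>
    have : expSum (0 + 1) = fun _ => (1 : ℝ) := by ext; simp [expSum]
    rw [this]
    simpa [expSum] using hasDerivAt_const x (1 : ℝ)
  | succ k ih =>
    have : expSum (k + 1 + 1) = fun x => expSum (k + 1) x + x ^ (k + 1) / ((k + 1)! : ℝ) := by
      ext; exact expSum_succ _ _
    rw [this, expSum_succ]
    exact ih.add (hasDerivAt_pow_succ_div_factorial k x)

theorem continuous_expSum (k : ℕ) : Continuous (expSum k) := by
  unfold expSum; fun_prop

/-! ### The incomplete gamma function at positive integers -/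

/-- In the derivative of `exp (-t) * expSum (n + 1) t` everything cancels except the top term, so an
antiderivative of the integrand is explicit. -/
theorem incompleteGamma_natCast_add_one (n : ℕ) {x : ℝ} (hx : 0 < x) :
    incompleteGamma ((n : ℝ) + 1) x = (n ! : ℝ) * (Real.exp (-x) * expSum (n + 1) x) := by
  have hn : (n ! : ℝ) ≠ 0 := by positivity
  have hderiv : ∀ t ∈ Ici x, HasDerivAt
      (fun t => -((n ! : ℝ) * (Real.exp (-t) * expSum (n + 1) t)))
      (t ^ ((n : ℝ) + 1 - 1) * Real.exp (-t)) t := by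
    intro t _
    have h1 : HasDerivAt (fun t : ℝ => Real.exp (-t)) (-Real.exp (-t)) t := by
      simpa using (hasDerivAt_neg t).exp
    have h := ((h1.mul (hasDerivAt_expSum_succ n t)).const_mul (n ! : ℝ)).neg
    refine h.congr_deriv ?_
    rw [expSum_succ, add_sub_cancel_right, Real.rpow_natCast]
    field_simp
    ring
  have hpos : ∀ t ∈ Ioi x, 0 ≤ t ^ ((n : ℝ) + 1 - 1) * Real.exp (-t) := by
    intro t ht
    have : 0 ≤ t := hx.le.trans (le_of_lt ht)
    positivity
  have hlim : Tendsto (fun t => -((n ! : ℝ) * (Real.exp (-t) * expSum (n + 1) t))) atTop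
      (𝓝 0) := by
    have h : Tendsto (fun t => Real.exp (-t) * expSum (n + 1) t) atTop (𝓝 0) := by
      have : (fun t => Real.exp (-t) * expSum (n + 1) t) =
          fun t => ∑ j ∈ Finset.range (n + 1), (t ^ j * Real.exp (-t)) / (j ! : ℝ) := by
        ext t
        rw [expSum, Finset.mul_sum]
        exact Finset.sum_congr rfl fun _ _ => by ring
      rw [this, ← Finset.sum_const_zero (s := Finset.range (n + 1))]
      refine tendsto_finsetSum _ fun j _ => ?_
      simpa using (Real.tendsto_pow_mul_exp_neg_atTop_nhds_zero j).div_const (j ! : ℝ)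
    simpa using (h.const_mul (n ! : ℝ)).neg
  rw [incompleteGamma, MeasureTheory.integral_Ioi_of_hasDerivAt_of_nonneg' hderiv hpos hlim]
  ring

theorem incompleteGamma_natCast {k : ℕ} (hk : 1 ≤ k) {x : ℝ} (hx : 0 < x) :
    incompleteGamma (k : ℝ) x = ((k - 1)! : ℝ) * (Real.exp (-x) * expSum k x) := by
  obtain ⟨n, rfl⟩ := Nat.exists_eq_add_of_le' hk
  have := incompleteGamma_natCast_add_one n hx
  push_cast
  rw [this]

/-! ### The breakpoints -/

/-- The function whose unique positive root is the `k`-th breakpoint. -/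
noncomputable def breakFun (k : ℕ) (x : ℝ) : ℝ := k * (x ^ k / (k ! : ℝ)) - expSum k x

/-- After the closed forms are inserted, the difference of the two sides is a positive multiple of
`breakFun k x`. -/
theorem incompleteGamma_eq_iff {k : ℕ} (hk : 1 ≤ k) {x : ℝ} (hx : 0 < x) :
    1 / ((k : ℝ) + 1) * incompleteGamma ((k : ℝ) + 1) x = incompleteGamma (k : ℝ) x ↔
      breakFun k x = 0 := by
  rw [incompleteGamma_natCast hk hx, incompleteGamma_natCast_add_one k hx, expSum_succ, breakFun]
  obtain ⟨n, rfl⟩ := Nat.exists_eq_add_of_le' hk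
  have h1 : (n ! : ℝ) ≠ 0 := by positivity
  have h3 : (n : ℝ) + 1 + 1 ≠ 0 := by positivity
  have h2 := Real.exp_ne_zero (-x)
  generalize x ^ (n + 1) / ((n + 1)! : ℝ) = u
  generalize expSum (n + 1) x = v
  rw [Nat.add_sub_cancel, Nat.factorial_succ]
  push_cast
  have : 1 / ((n : ℝ) + 1 + 1) * ((n + 1) * n ! * (Real.exp (-x) * (v + u))) -
      n ! * (Real.exp (-x) * v) =
      n ! * Real.exp (-x) / ((n : ℝ) + 1 + 1) * ((n + 1) * u - v) := by
    field_simp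
    ring
  rw [← sub_eq_zero, this]
  simp [h1, h2, h3]

/-- Induction on `breakFun (k + 1) x = breakFun k x + (x - k - 1) * (x ^ k / k !)`. This locates the
root in `(0, k]`. -/
theorem breakFun_nonneg_of_le (k : ℕ) {x : ℝ} (hx : (k : ℝ) ≤ x) : 0 ≤ breakFun k x := by
  induction k with
  | zero => simp [breakFun, expSum]
  | succ k ih =>
    have hk : (k : ℝ) ≤ x := by push_cast at hx; linarith
    have h0 : 0 ≤ x := (Nat.cast_nonneg k).trans hk
    have h := ih hk
    rw [breakFun] at h ⊢
    have h1 := pow_succ_div_factorial_succ k x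
    push_cast at hx ⊢
    rw [h1, expSum_succ]
    have h2 : 0 ≤ x ^ k / (k ! : ℝ) := by positivity
    nlinarith

/-- The sign depends on `expSum k x / x ^ k`, a sum of negative powers and so strictly decreasing.
Hence there is only one sign change. -/
theorem breakFun_pos_of_lt {k : ℕ} (hk : 1 ≤ k) {x y : ℝ} (hx : 0 < x) (hxy : x < y)
    (h : 0 ≤ breakFun k x) : 0 < breakFun k y := by
  have hy : 0 < y := hx.trans hxy
  have key : expSum k y * x ^ k < expSum k x * y ^ k := by
    rw [expSum, expSum, Finset.sum_mul, Finset.sum_mul]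
    refine Finset.sum_lt_sum_of_nonempty (by simp; omega) fun j hj => ?_
    have hjk : j < k := Finset.mem_range.1 hj
    obtain ⟨i, rfl⟩ := Nat.exists_eq_add_of_lt hjk
    have h1 : x ^ (i + 1) < y ^ (i + 1) := pow_lt_pow_left₀ hxy hx.le (by omega)
    have h2 : 0 < y ^ j / (j ! : ℝ) * x ^ j := by positivity
    calc y ^ j / (j ! : ℝ) * x ^ (j + i + 1) = y ^ j / (j ! : ℝ) * x ^ j * x ^ (i + 1) := by ring
      _ < y ^ j / (j ! : ℝ) * x ^ j * y ^ (i + 1) := by gcongr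
      _ = x ^ j / (j ! : ℝ) * y ^ (j + i + 1) := by ring
  rw [breakFun, sub_nonneg] at h
  rw [breakFun, sub_pos]
  have hxk : 0 < x ^ k := by positivity
  refine lt_of_mul_lt_mul_right ?_ hxk.le
  calc expSum k y * x ^ k < expSum k x * y ^ k := key
    _ ≤ (k * (x ^ k / (k ! : ℝ))) * y ^ k := by gcongr
    _ = _ := by ring

theorem continuous_breakFun (k : ℕ) : Continuous (breakFun k) := by
  have := continuous_expSum k
  unfold breakFun; fun_prop

theorem exists_breakFun_eq_zero {k : ℕ} (hk : 1 ≤ k) :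
    ∃ x : ℝ, 0 < x ∧ x ≤ k ∧ breakFun k x = 0 := by
  have h0 : breakFun k 0 < 0 := by
    have := one_le_expSum hk le_rfl
    have hk0 : k ≠ 0 := by omega
    simp only [breakFun, zero_pow hk0]
    simpa using lt_of_lt_of_le one_pos this
  obtain ⟨x, hx, h⟩ := intermediate_value_Icc (Nat.cast_nonneg (α := ℝ) k)
    (continuous_breakFun k).continuousOn ⟨h0.le, breakFun_nonneg_of_le k le_rfl⟩
  refine ⟨x, lt_of_le_of_ne hx.1 ?_, hx.2, h⟩
  rintro rfl
  exact h0.ne h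

open Classical in
/-- The `k`-th breakpoint. -/
noncomputable def breakpoint (k : ℕ) : ℝ :=
  if h : 1 ≤ k then (exists_breakFun_eq_zero h).choose else 0

theorem breakpoint_zero : breakpoint 0 = 0 := by simp [breakpoint]

theorem breakpoint_spec {k : ℕ} (hk : 1 ≤ k) :
    0 < breakpoint k ∧ breakpoint k ≤ k ∧ breakFun k (breakpoint k) = 0 := by
  rw [breakpoint, dif_pos hk]
  exact (exists_breakFun_eq_zero hk).choose_spec

theorem breakFun_neg_iff {k : ℕ} (hk : 1 ≤ k) {x : ℝ} (hx : 0 < x) :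
    breakFun k x < 0 ↔ x < breakpoint k := by
  obtain ⟨h1, -, h3⟩ := breakpoint_spec hk
  constructor
  · intro h
    by_contra! hle
    rcases hle.eq_or_lt with rfl | hlt
    · exact h.ne h3
    · exact (breakFun_pos_of_lt hk h1 hlt h3.ge).not_gt h
  · intro h
    by_contra! hle
    exact (breakFun_pos_of_lt hk hx h hle).ne' h3

theorem eq_breakpoint {k : ℕ} (hk : 1 ≤ k) {x : ℝ} (hx : 0 < x) (h : breakFun k x = 0) :
    x = breakpoint k := by
  obtain ⟨h1, -, h3⟩ := breakpoint_spec hk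
  refine le_antisymm ?_ ?_
  · by_contra! hlt
    exact (breakFun_pos_of_lt hk h1 hlt h3.ge).ne' h
  · by_contra! hlt
    exact ((breakFun_neg_iff hk hx).2 hlt).ne h

theorem breakpoint_nonneg (k : ℕ) : 0 ≤ breakpoint k := by
  rcases Nat.eq_zero_or_pos k with rfl | hk
  · exact breakpoint_zero.ge
  · exact (breakpoint_spec hk).1.le

/-- At a root `x ≤ k` of `breakFun k` the recursion gives `breakFun (k + 1) x = (x - k - 1) * (x ^ k
/ k !) < 0`, so the next root lies to the right. -/
theorem strictMono_breakpoint : StrictMono breakpoint := by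
  refine strictMono_nat_of_lt_succ fun k => ?_
  rcases Nat.eq_zero_or_pos k with rfl | hk
  · rw [breakpoint_zero]; exact (breakpoint_spec le_rfl).1
  · obtain ⟨h1, h2, h3⟩ := breakpoint_spec hk
    rw [← breakFun_neg_iff (by omega) h1]
    rw [breakFun] at h3 ⊢
    have h4 := pow_succ_div_factorial_succ k (breakpoint k)
    push_cast
    rw [h4, expSum_succ]
    have h5 : 0 < breakpoint k ^ k / (k ! : ℝ) := by positivity
    nlinarith

/-- At a fixed `x` the leading term of `breakFun (n + 1) x` is `x * x ^ n / n !`, which tends to 0,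
while the subtracted sum is at least 1. -/
theorem tendsto_breakpoint : Tendsto breakpoint atTop atTop := by
  refine strictMono_breakpoint.monotone.tendsto_atTop_atTop fun b => ?_
  set x := max b 1 with hx
  have hx0 : 0 < x := lt_of_lt_of_le one_pos (le_max_right _ _)
  have h := (FloorSemiring.tendsto_pow_div_factorial_atTop x).const_mul x
  rw [mul_zero] at h
  obtain ⟨n, hn⟩ := (h.eventually (gt_mem_nhds one_pos)).exists
  refine ⟨n + 1, (le_max_left b 1).trans (le_of_lt ?_)⟩
  rw [← hx, ← breakFun_neg_iff (by omega) hx0, breakFun]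
  have h4 := pow_succ_div_factorial_succ n x
  push_cast
  rw [h4]
  linarith [one_le_expSum (Nat.le_add_left 1 n) hx0.le]

theorem exists_mem_Ioc_breakpoint {x : ℝ} (hx : 0 < x) :
    ∃ k, 1 ≤ k ∧ x ∈ Ioc (breakpoint (k - 1)) (breakpoint k) := by
  classical
  have hex : ∃ k, x ≤ breakpoint k := (tendsto_breakpoint.eventually_ge_atTop x).exists
  have h1 : 1 ≤ Nat.find hex := by
    by_contra! h
    have := Nat.find_spec hex
    rw [Nat.lt_one_iff.1 h, breakpoint_zero] at this
    linarith
  exact ⟨Nat.find hex, h1, not_le.1 (Nat.find_min hex (by omega)), Nat.find_spec hex⟩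

/-! ### The throughput of rate `1 / k` in the Poisson limit -/

/-- The limiting throughput of a single message per user encoded at rate `1 / k`, decoded when at
most `k` users are active. -/
noncomputable def poissonRate (k : ℕ) (x : ℝ) : ℝ := x / k * (Real.exp (-x) * expSum k x)

theorem poissonRate_eq_incompleteGamma {k : ℕ} (hk : 1 ≤ k) {x : ℝ} (hx : 0 < x) :
    poissonRate k x = x / (k ! : ℝ) * incompleteGamma (k : ℝ) x := by
  rw [incompleteGamma_natCast hk hx, poissonRate]
  obtain ⟨n, rfl⟩ := Nat.exists_eq_add_of_le' hk
  have h1 : (n ! : ℝ) ≠ 0 := by positivity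
  rw [Nat.add_sub_cancel, Nat.factorial_succ]
  push_cast
  field_simp

theorem poissonRate_pos {k : ℕ} (hk : 1 ≤ k) {x : ℝ} (hx : 0 < x) : 0 < poissonRate k x := by
  have := one_le_expSum hk hx.le
  have : 0 < expSum k x := by linarith
  have : (0 : ℝ) < k := by exact_mod_cast hk
  unfold poissonRate
  positivity

theorem exp_neg_mul_expSum_le_one (k : ℕ) {x : ℝ} (hx : 0 ≤ x) :
    Real.exp (-x) * expSum k x ≤ 1 := by
  calc Real.exp (-x) * expSum k x ≤ Real.exp (-x) * Real.exp x := by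
        gcongr; exact expSum_le_exp k hx
    _ = 1 := by rw [← Real.exp_add]; simp

theorem mul_expSum_le (k : ℕ) {x : ℝ} (hx : 0 ≤ x) : x * expSum k x ≤ k * expSum (k + 1) x := by
  rw [expSum, expSum, Finset.sum_range_succ', mul_add, Finset.mul_sum, Finset.mul_sum]
  have : (0 : ℝ) ≤ k * (x ^ 0 / (0 ! : ℝ)) := by positivity
  refine le_add_of_le_of_nonneg (Finset.sum_le_sum fun j hj => ?_) this
  rw [← pow_succ_div_factorial_succ]
  have : (j : ℝ) + 1 ≤ k := by exact_mod_cast Finset.mem_range.1 hj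
  gcongr

theorem poissonRate_le_one (k : ℕ) {x : ℝ} (hx : 0 ≤ x) : poissonRate k x ≤ 1 := by
  rcases Nat.eq_zero_or_pos k with rfl | hk
  · simp [poissonRate]
  have hk' : (0 : ℝ) < k := by exact_mod_cast hk
  calc poissonRate k x = Real.exp (-x) * (x * expSum k x) / k := by rw [poissonRate]; ring
    _ ≤ Real.exp (-x) * (k * expSum (k + 1) x) / k := by
        gcongr ?_ * ?_ / _
        exact mul_expSum_le k hx
    _ = Real.exp (-x) * expSum (k + 1) x := by field_simp
    _ ≤ 1 := exp_neg_mul_expSum_le_one _ hx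

theorem poissonRate_succ_sub {k : ℕ} (hk : 1 ≤ k) (x : ℝ) :
    poissonRate (k + 1) x - poissonRate k x =
      x * Real.exp (-x) / (k * (k + 1)) * breakFun k x := by
  have : (k : ℝ) ≠ 0 := by positivity
  have : (k : ℝ) + 1 ≠ 0 := by positivity
  rw [poissonRate, poissonRate, expSum_succ, breakFun]
  push_cast
  generalize x ^ k / (k ! : ℝ) = u
  field_simp
  ring

/-- By `poissonRate_succ_sub` the rates increase with the index while the breakpoints lie below `x`
and do not increase afterwards. -/
theorem poissonRate_le_of_mem_Ioc {k : ℕ} {x : ℝ} (hx : 0 < x)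
    (hk : 1 ≤ k) (hxk : x ∈ Ioc (breakpoint (k - 1)) (breakpoint k)) {j : ℕ} (hj : 1 ≤ j) :
    poissonRate j x ≤ poissonRate k x := by
  have hpos : ∀ i : ℕ, 1 ≤ i → 0 < x * Real.exp (-x) / (i * (i + 1)) := fun i hi => by
    have : (0 : ℝ) < i := by exact_mod_cast hi
    positivity
  rcases le_total j k with hjk | hkj
  · induction k, hjk using Nat.le_induction with
    | base => exact le_rfl
    | succ i hji ih =>
      have hi : 1 ≤ i := hj.trans hji
      have hi' : breakpoint i < x := hxk.1
      have hstep : poissonRate i x ≤ poissonRate (i + 1) x := by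
        rw [← sub_nonneg, poissonRate_succ_sub hi]
        refine mul_nonneg (hpos i hi).le ?_
        by_contra! h
        exact hi'.not_gt ((breakFun_neg_iff hi hx).1 h)
      refine le_trans ?_ hstep
      clear ih hxk hstep
      induction i, hji using Nat.le_induction with
      | base => exact le_rfl
      | succ l hjl ih =>
        have hl : 1 ≤ l := hj.trans hjl
        have hl' : breakpoint l < x := (strictMono_breakpoint (Nat.lt_succ_self l)).trans hi'
        refine (ih (by omega) hl hl').trans ?_
        rw [← sub_nonneg, poissonRate_succ_sub hl]
        refine mul_nonneg (hpos l hl).le ?_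
        by_contra! h
        exact hl'.not_gt ((breakFun_neg_iff hl hx).1 h)
  · induction j, hkj using Nat.le_induction with
    | base => exact le_rfl
    | succ i hki ih =>
      have hi : 1 ≤ i := hk.trans hki
      refine le_trans ?_ (ih hi)
      have hxi : x ≤ breakpoint i := hxk.2.trans (strictMono_breakpoint.monotone hki)
      rw [← sub_nonpos, poissonRate_succ_sub hi]
      refine mul_nonpos_of_nonneg_of_nonpos (hpos i hi).le ?_
      rcases hxi.eq_or_lt with h | h
      · rw [h]; exact (breakpoint_spec hi).2.2.le
      · exact ((breakFun_neg_iff hi hx).2 h).le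

theorem hasDerivAt_poissonRate {k : ℕ} (hk : 1 ≤ k) (x : ℝ) :
    HasDerivAt (poissonRate k) (-(1 / (k : ℝ)) * (Real.exp (-x) * breakFun k x)) x := by
  obtain ⟨n, rfl⟩ := Nat.exists_eq_add_of_le' hk
  have h1 : HasDerivAt (fun t : ℝ => Real.exp (-t)) (-Real.exp (-x)) x := by
    simpa using (hasDerivAt_neg x).exp
  have h := ((hasDerivAt_id x).div_const ((n + 1 : ℕ) : ℝ)).mul
    (h1.mul (hasDerivAt_expSum_succ n x))
  refine h.congr_deriv ?_
  have h4 := pow_succ_div_factorial_succ n x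
  have h5 : ((n : ℝ) + 1) ≠ 0 := by positivity
  have h6 := expSum_succ n x
  rw [breakFun]
  push_cast
  rw [h4, h6]
  simp only [id, Pi.mul_apply]
  rw [h6]
  generalize x ^ n / (n ! : ℝ) = u
  field_simp
  ring

theorem hasDerivAt_exp_neg_mul_breakFun {k : ℕ} (hk : 1 ≤ k) (x : ℝ) :
    HasDerivAt (fun x => Real.exp (-x) * breakFun k x)
      (Real.exp (-x) * (x ^ (k - 1) / ((k - 1)! : ℝ) * ((k : ℝ) + 1 - x))) x := by
  obtain ⟨n, rfl⟩ := Nat.exists_eq_add_of_le' hk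
  have h1 : HasDerivAt (fun t : ℝ => Real.exp (-t)) (-Real.exp (-x)) x := by
    simpa using (hasDerivAt_neg x).exp
  have h := h1.mul (((hasDerivAt_pow_succ_div_factorial n x).const_mul ((n + 1 : ℕ) : ℝ)).sub
    (hasDerivAt_expSum_succ n x))
  refine h.congr_deriv ?_
  have h4 := pow_succ_div_factorial_succ n x
  have h6 := expSum_succ n x
  push_cast
  simp only [Pi.sub_apply]
  rw [h4, h6]
  generalize x ^ n / (n ! : ℝ) = u
  ring

/-- The second derivative has the sign of `x - (k + 1)`, and `x ≤ breakpoint k ≤ k` here. -/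
theorem concaveOn_poissonRate {k : ℕ} (hk : 1 ≤ k) :
    ConcaveOn ℝ (Ioc (breakpoint (k - 1)) (breakpoint k)) (poissonRate k) := by
  have hd : deriv (poissonRate k) =
      fun x => -(1 / (k : ℝ)) * (Real.exp (-x) * breakFun k x) :=
    funext fun x => (hasDerivAt_poissonRate hk x).deriv
  refine concaveOn_of_deriv2_nonpos' (convex_Ioc _ _)
    (fun x _ => (hasDerivAt_poissonRate hk x).differentiableAt.differentiableWithinAt) ?_ ?_
  · rw [hd]
    exact fun x _ => ((hasDerivAt_exp_neg_mul_breakFun hk x).const_mul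
      _).differentiableAt.differentiableWithinAt
  · intro x hx
    have hx0 : 0 < x := (breakpoint_nonneg _).trans_lt hx.1
    have hxk : x ≤ k := hx.2.trans (breakpoint_spec hk).2.1
    rw [Function.iterate_succ, Function.iterate_one, Function.comp_apply, hd,
      ((hasDerivAt_exp_neg_mul_breakFun hk x).const_mul _).deriv]
    have : 0 ≤ (k : ℝ) + 1 - x := by linarith
    have : 0 ≤ (1 / (k : ℝ)) *
        (Real.exp (-x) * (x ^ (k - 1) / ((k - 1)! : ℝ) * ((k : ℝ) + 1 - x))) := by positivity
    linarith

theorem strictMonoOn_poissonRate {k : ℕ} (hk : 1 ≤ k) :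
    StrictMonoOn (poissonRate k) (Ioc (breakpoint (k - 1)) (breakpoint k)) := by
  refine strictMonoOn_of_deriv_pos (convex_Ioc _ _)
    (fun x _ => (hasDerivAt_poissonRate hk x).continuousAt.continuousWithinAt) fun x hx => ?_
  rw [interior_Ioc] at hx
  have hx0 : 0 < x := (breakpoint_nonneg _).trans_lt hx.1
  rw [(hasDerivAt_poissonRate hk x).deriv]
  have h := (breakFun_neg_iff hk hx0).2 hx.2
  have hk' : (0 : ℝ) < k := by exact_mod_cast hk
  have : 0 < (1 / (k : ℝ)) * (Real.exp (-x) * -breakFun k x) := by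
    have : 0 < -breakFun k x := by linarith
    positivity
  linarith

/-! ### The limiting throughput -/

/-- The supremum over `k` of the throughput of rate `1 / k` in the Poisson limit. -/
noncomputable def poissonThroughput (x : ℝ) : ℝ := ⨆ k : ℕ, poissonRate (k + 1) x

theorem poissonThroughput_eq {k : ℕ} (hk : 1 ≤ k) {x : ℝ}
    (hx : x ∈ Ioc (breakpoint (k - 1)) (breakpoint k)) :
    poissonThroughput x = poissonRate k x := by
  have hx0 : 0 < x := (breakpoint_nonneg _).trans_lt hx.1
  have hle : ∀ j : ℕ, poissonRate (j + 1) x ≤ poissonRate k x := fun j =>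
    poissonRate_le_of_mem_Ioc hx0 hk hx (by omega)
  refine le_antisymm (ciSup_le hle) ?_
  have := le_ciSup (f := fun j : ℕ => poissonRate (j + 1) x)
    ⟨_, forall_mem_range.2 hle⟩ (k - 1)
  rwa [Nat.sub_add_cancel hk] at this

theorem poissonRate_le_poissonThroughput {k : ℕ} (hk : 1 ≤ k) {x : ℝ} (hx : 0 < x) :
    poissonRate k x ≤ poissonThroughput x := by
  obtain ⟨j, hj, hxj⟩ := exists_mem_Ioc_breakpoint hx
  rw [poissonThroughput_eq hj hxj]
  exact poissonRate_le_of_mem_Ioc hx hj hxj hk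

theorem poissonThroughput_pos {x : ℝ} (hx : 0 < x) : 0 < poissonThroughput x :=
  (poissonRate_pos le_rfl hx).trans_le (poissonRate_le_poissonThroughput le_rfl hx)

/-- Near a given point only finitely many `k` can be optimal, so the supremum is locally a finite
maximum of continuous functions. -/
theorem continuousOn_poissonThroughput : ContinuousOn poissonThroughput (Ioi 0) := by
  intro x hx
  obtain ⟨K, hK⟩ := (tendsto_breakpoint.eventually_gt_atTop x).exists
  have hne : (Finset.Icc 1 (K + 1)).Nonempty := ⟨1, by simp⟩
  have hc : ContinuousAt (fun y => (Finset.Icc 1 (K + 1)).sup' hne fun k => poissonRate k y) x :=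
    ContinuousAt.finset_sup'_apply hne fun k hk =>
      (hasDerivAt_poissonRate (Finset.mem_Icc.1 hk).1 x).continuousAt
  refine (hc.congr ?_).continuousWithinAt
  filter_upwards [Ioo_mem_nhds hx hK] with y hy
  obtain ⟨j, hj, hyj⟩ := exists_mem_Ioc_breakpoint hy.1
  refine le_antisymm (Finset.sup'_le _ _ fun k hk =>
    poissonRate_le_poissonThroughput (Finset.mem_Icc.1 hk).1 hy.1) ?_
  rw [poissonThroughput_eq hj hyj]
  refine Finset.le_sup' (fun k => poissonRate k y) (Finset.mem_Icc.2 ⟨hj, ?_⟩)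
  have : j - 1 < K := strictMono_breakpoint.lt_iff_lt.1 (hyj.1.trans hy.2)
  omega

theorem poissonThroughput_le_one {x : ℝ} (hx : 0 < x) : poissonThroughput x ≤ 1 :=
  ciSup_le fun _ => poissonRate_le_one _ hx.le

/-- Chernoff's bound: the tail term of index `j + k` is multiplied by `s ^ j ≥ 1`. -/
theorem exp_sub_expSum_le {k : ℕ} {x s : ℝ} (hx : 0 ≤ x) (hs : 1 ≤ s) :
    Real.exp x - expSum k x ≤ Real.exp (s * x) / s ^ k := by
  have hs0 : 0 < s := by linarith
  have h1 : HasSum (fun j : ℕ => x ^ j / (j ! : ℝ)) (Real.exp x) := by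
    rw [Real.exp_eq_exp_ℝ]; exact NormedSpace.expSeries_div_hasSum_exp x
  have h2 : HasSum (fun j : ℕ => (s * x) ^ j / (j ! : ℝ)) (Real.exp (s * x)) := by
    rw [Real.exp_eq_exp_ℝ]; exact NormedSpace.expSeries_div_hasSum_exp (s * x)
  have h1' := (hasSum_nat_add_iff' k).2 h1
  have h2' := ((hasSum_nat_add_iff' k).2 h2).div_const (s ^ k)
  have h3 := hasSum_le (fun j => ?_) h1' h2'
  · refine h3.trans ?_
    gcongr
    exact sub_le_self _ (Finset.sum_nonneg fun _ _ => by positivity)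
  · show x ^ (j + k) / ((j + k)! : ℝ) ≤ (s * x) ^ (j + k) / ((j + k)! : ℝ) / s ^ k
    have : (s * x) ^ (j + k) / ((j + k)! : ℝ) / s ^ k =
        s ^ j * (x ^ (j + k) / ((j + k)! : ℝ)) := by
      rw [mul_pow, pow_add s]; field_simp
    rw [this]
    exact le_mul_of_one_le_left (by positivity) (one_le_pow₀ hs)

theorem tendsto_poissonThroughput : Tendsto poissonThroughput atTop (𝓝 1) := by
  refine tendsto_order.2 ⟨fun a ha => ?_, fun a ha => ?_⟩
  swap
  · filter_upwards [eventually_gt_atTop 0] with x hx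
    exact (poissonThroughput_le_one hx).trans_lt ha
  obtain ⟨ε, hε, hεa⟩ : ∃ ε : ℝ, 0 < ε ∧ a < 1 / (1 + ε) := by
    have hc : Tendsto (fun ε : ℝ => 1 / (1 + ε)) (𝓝[>] 0) (𝓝 1) := by
      have : ContinuousAt (fun ε : ℝ => 1 / (1 + ε)) 0 := by
        refine ContinuousAt.div continuousAt_const (by fun_prop) (by norm_num)
      have h := this.tendsto
      simp only [add_zero, div_one] at h
      exact h.mono_left nhdsWithin_le_nhds
    obtain ⟨ε, h1, h2⟩ := ((hc.eventually (lt_mem_nhds ha)).and self_mem_nhdsWithin).exists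
    exact ⟨ε, h2, h1⟩
  set s := 1 + ε with hs
  have hs1 : 1 < s := by linarith
  have hs0 : 0 < s := by linarith
  -- `c = s log s - s + 1` is the exponent of the Poisson upper tail at `s` times the mean.
  set c := s * Real.log s - ε with hc
  have hcpos : 0 < c := by
    have h : 1 - s⁻¹ < Real.log s := by
      have := Real.log_lt_sub_one_of_pos (inv_pos.2 hs0) (inv_ne_one.2 hs1.ne')
      rw [Real.log_inv] at this
      linarith
    have : s * (1 - s⁻¹) < s * Real.log s := by gcongr
    rw [mul_sub, mul_inv_cancel₀ hs0.ne'] at this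
    linarith
  have hlow : ∀ x : ℝ, 0 < x →
      x / (s * x + 1) * (1 - Real.exp (-(c * x))) ≤ poissonThroughput x := by
    intro x hx
    have hsx : 0 < s * x := by positivity
    -- Designing for slightly more than the mean number of active users costs a factor `1/s` in rate
    -- but makes overload exponentially rare.
    set k := ⌈s * x⌉₊ with hk
    have hk1 : 1 ≤ k := Nat.one_le_iff_ne_zero.2 (Nat.ceil_pos.2 hsx).ne'
    have hk2 : s * x ≤ k := Nat.le_ceil _
    have hk3 : (k : ℝ) ≤ s * x + 1 := (Nat.ceil_lt_add_one hsx.le).le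
    have hk0 : (0 : ℝ) < k := by exact_mod_cast hk1
    refine le_trans ?_ (poissonRate_le_poissonThroughput hk1 hx)
    have htail : 1 - Real.exp (-(c * x)) ≤ Real.exp (-x) * expSum k x := by
      have h1 := exp_sub_expSum_le (k := k) hx.le hs1.le
      have h2 : Real.exp (s * Real.log s * x) ≤ s ^ k := by
        rw [← Real.rpow_natCast, Real.rpow_def_of_pos hs0, Real.exp_le_exp]
        have := Real.log_pos hs1
        nlinarith
      have h3 : Real.exp x - expSum k x ≤ Real.exp (s * x) / Real.exp (s * Real.log s * x) :=
        h1.trans (by gcongr)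
      rw [← Real.exp_sub] at h3
      have h4 := mul_le_mul_of_nonneg_left h3 (Real.exp_pos (-x)).le
      rw [mul_sub, ← Real.exp_add, ← Real.exp_add, neg_add_cancel, Real.exp_zero] at h4
      have h5 : -x + (s * x - s * Real.log s * x) = -(c * x) := by rw [hc, hs]; ring
      rw [h5] at h4
      linarith
    have hnn : 0 ≤ 1 - Real.exp (-(c * x)) := by
      have : Real.exp (-(c * x)) ≤ 1 := Real.exp_le_one_iff.2 (by nlinarith)
      linarith
    rw [poissonRate]
    gcongr
  have hlim : Tendsto (fun x : ℝ => x / (s * x + 1) * (1 - Real.exp (-(c * x)))) atTop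
      (𝓝 (1 / s * (1 - 0))) := by
    refine Tendsto.mul ?_ (tendsto_const_nhds.sub ?_)
    · have h : Tendsto (fun x : ℝ => 1 / (s + x⁻¹)) atTop (𝓝 (1 / (s + 0))) :=
        tendsto_const_nhds.div (tendsto_const_nhds.add tendsto_inv_atTop_zero) (by simpa using hs0.ne')
      rw [add_zero] at h
      refine h.congr' ?_
      filter_upwards [eventually_gt_atTop 0] with x hx
      field_simp
    · exact Real.tendsto_exp_neg_atTop_nhds_zero.comp (tendsto_id.const_mul_atTop hcpos)
  rw [sub_zero, mul_one] at hlim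
  filter_upwards [hlim.eventually (lt_mem_nhds hεa), eventually_gt_atTop 0] with x h1 h2
  exact h1.trans_le (hlow x h2)

/-! ### The converse: nested sets of active users -/

section Counting

variable {ι : Type*} [DecidableEq ι]

/-- The sum of `f A i` along the chain of sets of users that a list builds up from its end, where
`i` is the user added in forming `A`. -/
def chainSum (f : Finset ι → ι → ℝ) : List ι → ℝ
  | [] => 0
  | a :: t => f (insert a t.toFinset) a + chainSum f t

/-- The product of `f A i` along the chain of sets of users that a list builds up from its end,
where `i` is the user added in forming `A`. -/
def chainProd (f : Finset ι → ι → ℕ) : List ι → ℕ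
  | [] => 1
  | a :: t => f (insert a t.toFinset) a * chainProd f t

variable [Fintype ι] {M : ι → Type*} [∀ i, Fintype (M i)]

-- Exchanging `x` with the coordinate `w a` is an involution of the pairs `(x, w)`.
open Classical in
theorem sum_card_slice (a : ι) (S : Finset (∀ i, M i)) :
    ∑ x : M a, (Finset.univ.filter fun w => Function.update w a x ∈ S).card =
      Fintype.card (M a) * S.card := by
  let e : M a × (∀ i, M i) ≃ M a × (∀ i, M i) :=
    Function.Involutive.toPerm (fun p => (p.2 a, Function.update p.2 a p.1)) fun p => by simp
  have h := Fintype.sum_equiv e (fun p => if Function.update p.2 a p.1 ∈ S then 1 else 0)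
    (fun p => if p.2 ∈ S then 1 else 0) fun p => rfl
  rw [Fintype.sum_prod_type, Fintype.sum_prod_type] at h
  simp only [Finset.sum_boole, Finset.sum_const, Finset.card_univ,
    smul_eq_mul, Nat.cast_id, Finset.filter_univ_mem] at h
  exact h

open Classical in
/-- If, on a set `S` of tuples of messages containing almost all of them, at every step of a chain
of sets of users the output determines the decoded part of the messages of the last user, then the
number of outputs on `S` is nearly as large as the product of the sizes of the decoded parts. -/
theorem chainProd_le_card_image {Y : Type*} [AddCommGroup Y]
    [DecidableEq Y] [DecidableEq (∀ i, M i)] (enc : ∀ i, M i → Y)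
    {D : Finset ι → ι → Type*} [∀ A i, Fintype (D A i)] (proj : ∀ A i, M i → D A i)
    (hproj : ∀ A i (d : D A i),
      (Finset.univ.filter fun x => proj A i x = d).card * Fintype.card (D A i) ≤
        Fintype.card (M i))
    (dec : ∀ A i, Y → D A i) (l : List ι) (hl : l.Nodup) (S : Finset (∀ i, M i))
    (hdec : ∀ a t, (a :: t) <:+ l → ∀ w ∈ S,
      dec (insert a t.toFinset) a (∑ i ∈ insert a t.toFinset, enc i (w i)) =
        proj (insert a t.toFinset) a (w a))
    (hS : Sᶜ.card * 2 ^ l.length < Fintype.card (∀ i, M i)) :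
    chainProd (fun A i => Fintype.card (D A i)) l ≤
      2 ^ l.length * (S.image fun w => ∑ i ∈ l.toFinset, enc i (w i)).card := by
  induction l generalizing S with
  | nil =>
    simp only [chainProd, List.length_nil, pow_zero, one_mul, mul_one] at hS ⊢
    rw [Nat.one_le_iff_ne_zero, Finset.card_ne_zero, Finset.image_nonempty]
    by_contra h
    rw [Finset.not_nonempty_iff_eq_empty] at h
    simp [h] at hS
  | cons a t ih =>
    obtain ⟨hat, ht⟩ := List.nodup_cons.1 hl
    set N := Fintype.card (∀ i, M i) with hN
    set A := insert a t.toFinset with hA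
    have hMa : 0 < Fintype.card (M a) := by
      have : 0 < N := by omega
      obtain ⟨w⟩ := Fintype.card_pos_iff.1 this
      exact Fintype.card_pos_iff.2 ⟨w a⟩
    let slice : M a → Finset (∀ i, M i) := fun x =>
      Finset.univ.filter fun w => Function.update w a x ∈ S
    have hslice : ∀ x w, w ∈ slice x ↔ Function.update w a x ∈ S := fun x w => by simp [slice]
    have hsum : ∑ x : M a, (slice x)ᶜ.card = Fintype.card (M a) * Sᶜ.card := by
      rw [← sum_card_slice]
      refine Finset.sum_congr rfl fun x _ => congrArg _ ?_
      ext w; simp [slice]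
    have hout : ∀ x (B : Finset ι), a ∉ B → ∀ w : ∀ i, M i,
        ∑ i ∈ B, enc i (Function.update w a x i) = ∑ i ∈ B, enc i (w i) := by
      intro x B hB w
      refine Finset.sum_congr rfl fun i hi => ?_
      rw [Function.update_of_ne (by rintro rfl; exact hB hi)]
    have hat' : a ∉ t.toFinset := by simpa using hat
    -- for at least half of the messages of `a` the slice is large
    let X : Finset (M a) := Finset.univ.filter fun x => (slice x)ᶜ.card * 2 ^ t.length < N
    have hX : Fintype.card (M a) ≤ 2 * X.card := by
      -- Markov's inequality: a message outside `X` has at least `N / 2 ^ t.length` bad tuples in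
      -- its slice, and `hsum` bounds the total.
      have h1 : Xᶜ.card * N ≤ Fintype.card (M a) * Sᶜ.card * 2 ^ t.length := by
        rw [← hsum, Finset.sum_mul]
        calc Xᶜ.card * N ≤ ∑ x ∈ Xᶜ, (slice x)ᶜ.card * 2 ^ t.length := by
              rw [← smul_eq_mul]
              exact Finset.card_nsmul_le_sum _ _ _ fun x hx => by simpa [X] using hx
          _ ≤ _ := Finset.sum_le_univ_sum_of_nonneg fun _ => Nat.zero_le _
      have h2 : Xᶜ.card + X.card = Fintype.card (M a) := Finset.card_compl_add_card X
      rw [List.length_cons, pow_succ] at hS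
      have h3 : 2 * Xᶜ.card * N < Fintype.card (M a) * N := by
        calc 2 * Xᶜ.card * N ≤ Fintype.card (M a) * (Sᶜ.card * (2 ^ t.length * 2)) := by
              nlinarith
          _ < _ := by gcongr
      have := lt_of_mul_lt_mul_right h3 (Nat.zero_le _)
      omega
    let P : Finset (D A a) := X.image (proj A a)
    -- Each fibre of `proj A a` holds at most a fraction `1 / |D A a|` of the messages, so half of
    -- the messages meet at least half of the decoded values.
    have hP : Fintype.card (D A a) ≤ 2 * P.card := by
      have h1 : X.card * Fintype.card (D A a) ≤ P.card * Fintype.card (M a) := by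
        rw [Finset.card_eq_sum_card_image (proj A a) X, Finset.sum_mul, ← smul_eq_mul]
        refine Finset.sum_le_card_nsmul _ _ _ fun d _ => le_trans ?_ (hproj A a d)
        gcongr
        exact Finset.subset_univ X
      refine le_of_mul_le_mul_right ?_ hMa
      nlinarith
    have hrep : ∀ d : P, ∃ x ∈ X, proj A a x = d := fun d => Finset.mem_image.1 d.2
    choose rep hrepX hrepd using hrep
    -- `O d` is the set of outputs with the message of `a` frozen at `rep d`: a translate of outputs
    -- of `t`. The decoder reads `d` off them, so these sets are disjoint.
    let O : P → Finset Y := fun d =>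
      ((slice (rep d)).image fun w => ∑ i ∈ t.toFinset, enc i (w i)).map
        (addLeftEmbedding (enc a (rep d)))
    have hO : ∀ d, chainProd (fun A i => Fintype.card (D A i)) t ≤ 2 ^ t.length * (O d).card := by
      intro d
      rw [Finset.card_map]
      refine ih ht (slice (rep d)) ?_ (Finset.mem_filter.1 (hrepX d)).2
      intro b s hs w hw
      have hw' := hdec b s (hs.trans (List.suffix_cons a t)) _ ((hslice _ _).1 hw)
      have hmem : ∀ c ∈ insert b s.toFinset, c ∈ t := fun c hc => by
        refine hs.subset ?_
        simpa using hc
      rw [hout _ _ fun h => hat (hmem a h), Function.update_of_ne] at hw'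
      · exact hw'
      · rintro rfl
        exact hat (hmem _ (Finset.mem_insert_self _ _))
    have hOmem : ∀ d, ∀ y ∈ O d, dec A a y = d ∧
        y ∈ S.image fun w => ∑ i ∈ (a :: t).toFinset, enc i (w i) := by
      intro d y hy
      obtain ⟨z, hz, rfl⟩ := Finset.mem_map.1 hy
      obtain ⟨w, hw, rfl⟩ := Finset.mem_image.1 hz
      have hwS := (hslice _ _).1 hw
      have hval : addLeftEmbedding (enc a (rep d)) (∑ i ∈ t.toFinset, enc i (w i)) =
          ∑ i ∈ A, enc i (Function.update w a (rep d) i) := by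
        rw [hA, Finset.sum_insert hat', hout _ _ hat', Function.update_self]
        rfl
      refine ⟨?_, ?_⟩
      · have := hdec a t List.suffix_rfl _ hwS
        rw [hval, this, Function.update_self, hrepd]
      · rw [hval, List.toFinset_cons]
        exact Finset.mem_image.2 ⟨_, hwS, rfl⟩
    have hdisj : ∀ d ∈ (Finset.univ : Finset P), ∀ d' ∈ (Finset.univ : Finset P), d ≠ d' →
        Disjoint (O d) (O d') := by
      intro d _ d' _ hne
      refine Finset.disjoint_left.2 fun y hy hy' => hne (Subtype.ext ?_)
      rw [← (hOmem d y hy).1, (hOmem d' y hy').1]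
    have hcard : P.card * chainProd (fun A i => Fintype.card (D A i)) t ≤
        2 ^ t.length * (S.image fun w => ∑ i ∈ (a :: t).toFinset, enc i (w i)).card := by
      calc P.card * chainProd (fun A i => Fintype.card (D A i)) t
          ≤ ∑ d : P, 2 ^ t.length * (O d).card := by
            have := Finset.card_nsmul_le_sum (Finset.univ : Finset P) _ _ fun d _ => hO d
            simpa using this
        _ = 2 ^ t.length * (Finset.univ.biUnion O).card := by
            rw [Finset.card_biUnion hdisj, Finset.mul_sum]
        _ ≤ _ := by
            gcongr
            exact Finset.biUnion_subset.2 fun d _ y hy => (hOmem d y hy).2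
    calc chainProd (fun A i => Fintype.card (D A i)) (a :: t)
        = Fintype.card (D A a) * chainProd (fun A i => Fintype.card (D A i)) t := rfl
      _ ≤ 2 * P.card * chainProd (fun A i => Fintype.card (D A i)) t := by gcongr
      _ ≤ 2 * (2 ^ t.length *
          (S.image fun w => ∑ i ∈ (a :: t).toFinset, enc i (w i)).card) := by
          rw [mul_assoc]; gcongr
      _ = _ := by rw [List.length_cons, pow_succ]; ring

end Counting

/-! ### Bounds on the capacity region -/

variable {m : ℕ}

/-- The rate of user `i` in state `A`, extended by `0` to inactive users. -/
noncomputable def extendRate (r : RateTuple m) (A : Finset (Fin m)) (i : Fin m) : ℝ :=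
  if h : i ∈ A then r A ⟨i, h⟩ else 0

/-- The messages of user `i` decoded in state `A`; none if `i` is inactive. -/
abbrev DecodedIndex (W : MessageStructure m) (A : Finset (Fin m)) (i : Fin m) : Type :=
  {j : Fin (W.num i) // ∃ h : i ∈ A, j ∈ W.decoded A ⟨i, h⟩}

theorem le_messageCard (n : ℕ) (R : ℝ) : (2 : ℝ) ^ ((n : ℝ) * R) ≤ messageCard n R :=
  Nat.le_ceil _

theorem messageCard_pos (n : ℕ) (R : ℝ) : 0 < messageCard n R :=
  Nat.ceil_pos.2 (by positivity)

open Classical in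
theorem rpow_extendRate_le_prod_messageCard {W : MessageStructure m} {R : W.Rates}
    {r : RateTuple m} (hr : ∀ (A : Finset (Fin m)) (i : A), r A i = ∑ j ∈ W.decoded A i, R i j)
    (n : ℕ) {A : Finset (Fin m)} {i : Fin m} (hi : i ∈ A) :
    (2 : ℝ) ^ ((n : ℝ) * extendRate r A i) ≤
      (Fintype.card ((j : DecodedIndex W A i) → Fin (messageCard n (R i j))) : ℝ) := by
  have h1 : extendRate r A i = ∑ j : DecodedIndex W A i, R i j := by
    rw [extendRate, dif_pos hi, hr]
    exact Finset.sum_subtype _ (fun j => by simp [hi]) _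
  rw [h1, Finset.mul_sum, Real.rpow_sum_of_pos two_pos, Fintype.card_pi]
  push_cast
  refine Finset.prod_le_prod (fun _ _ => by positivity) fun j _ => ?_
  simpa using le_messageCard n (R i j)

theorem rpow_chainSum_le_chainProd {ι : Type*} [DecidableEq ι] {f : Finset ι → ι → ℝ}
    {c : Finset ι → ι → ℕ} {n : ℕ}
    (h : ∀ A, ∀ i ∈ A, (2 : ℝ) ^ ((n : ℝ) * f A i) ≤ c A i) (l : List ι) :
    (2 : ℝ) ^ ((n : ℝ) * chainSum f l) ≤ chainProd c l := by
  induction l with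
  | nil => simp [chainSum, chainProd]
  | cons a t ih =>
    rw [chainSum, chainProd, mul_add, Real.rpow_add two_pos]
    push_cast
    exact mul_le_mul (h _ a (Finset.mem_insert_self _ _)) ih (by positivity) (by positivity)

-- Overwriting the coordinates in `p` of a point of the fibre is injective: the overwritten part can
-- be read off, and the original part is `d`.
open Classical in
theorem card_restrict_fiber_mul_le {J : Type*} [Fintype J] [DecidableEq J] {V : J → Type*}
    [∀ j, Fintype (V j)] (p : J → Prop) [Fintype {j // p j}] (d : (j : {j // p j}) → V j) :
    (Finset.univ.filter fun x : (j : J) → V j => (fun j : {j // p j} => x j) = d).card *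
      Fintype.card ((j : {j // p j}) → V j) ≤ Fintype.card ((j : J) → V j) := by
  rw [← Fintype.card_subtype, ← Fintype.card_prod]
  refine Fintype.card_le_of_injective
    (fun q : {x : (j : J) → V j // (fun j : {j // p j} => x j) = d} × ((j : {j // p j}) → V j) =>
      fun j => if h : p j then q.2 ⟨j, h⟩ else q.1.1 j) ?_
  rintro ⟨⟨x, hx⟩, e⟩ ⟨⟨x', hx'⟩, e'⟩ h
  have hj : ∀ j, _ := fun j => congrFun h j
  have he : e = e' := by
    ext ⟨j, hpj⟩
    simpa [hpj] using hj j
  have hxx : x = x' := by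
    ext j
    by_cases hpj : p j
    · exact congrFun (hx.trans hx'.symm) ⟨j, hpj⟩
    · simpa [hpj] using hj j
  subst he hxx
  rfl

open Classical in
/-- The message tuples for which the decoder for the set `A` of active users makes an error. -/
noncomputable def Code.errorSet {W : MessageStructure m} {R : W.Rates} {n : ℕ}
    (c : Code W R n) (A : Finset (Fin m)) : Finset (Messages W R n) :=
  Finset.univ.filter fun w : Messages W R n =>
    ∃ (i : A) (j : W.decoded A i), c.decode A (c.output A w) i j ≠ w i j

theorem Code.errorProb_eq {W : MessageStructure m} {R : W.Rates} {n : ℕ}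
    (c : Code W R n) (A : Finset (Fin m)) :
    c.errorProb A = ((c.errorSet A).card : ℝ) / Fintype.card (Messages W R n) := rfl

theorem Code.decode_eq_of_notMem_errorSet {W : MessageStructure m} {R : W.Rates} {n : ℕ}
    {c : Code W R n} {A : Finset (Fin m)} {w : Messages W R n} (hw : w ∉ c.errorSet A)
    (i : A) (j : W.decoded A i) : c.decode A (c.output A w) i j = w i j := by
  by_contra h
  exact hw (Finset.mem_filter.2 ⟨Finset.mem_univ _, i, j, h⟩)

/-- A code whose total error probability is small satisfies the chain bounds up to a constant. -/
theorem rpow_chainSum_le_of_errorProb {W : MessageStructure m} {R : W.Rates} {r : RateTuple m}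
    (hr : ∀ (A : Finset (Fin m)) (i : A), r A i = ∑ j ∈ W.decoded A i, R i j)
    {n : ℕ} (c : Code W R n) {l : List (Fin m)} (hl : l.Nodup)
    (hc : (∑ A, c.errorProb A) * 2 ^ l.length < 1) :
    (2 : ℝ) ^ ((n : ℝ) * chainSum (extendRate r) l) ≤ 2 ^ l.length * 2 ^ n := by
  classical
  have hN : 0 < Fintype.card (Messages W R n) :=
    Fintype.card_pos_iff.2 ⟨fun i j => ⟨0, messageCard_pos n _⟩⟩
  have hS : (Finset.univ.biUnion c.errorSet).card * 2 ^ l.length < Fintype.card (Messages W R n) := by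
    simp_rw [Code.errorProb_eq, ← Finset.sum_div] at hc
    rw [div_mul_eq_mul_div, div_lt_one (by exact_mod_cast hN)] at hc
    have h1 : (Finset.univ.biUnion c.errorSet).card ≤ ∑ A, (c.errorSet A).card := Finset.card_biUnion_le
    have h2 : (∑ A, (c.errorSet A).card) * 2 ^ l.length < Fintype.card (Messages W R n) := by
      exact_mod_cast hc
    exact (Nat.mul_le_mul_right _ h1).trans_lt h2
  have hgood : ∀ (A : Finset (Fin m)) (i : Fin m), ∀ w ∈ (Finset.univ.biUnion c.errorSet)ᶜ,
      (fun j : DecodedIndex W A i => c.decode A (c.output A w) ⟨i, j.2.fst⟩ ⟨j, j.2.snd⟩) =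
        fun j : DecodedIndex W A i => w i j := by
    intro A i w hw
    have hA : w ∉ c.errorSet A := fun h =>
      Finset.mem_compl.1 hw (Finset.mem_biUnion.2 ⟨A, Finset.mem_univ A, h⟩)
    exact funext fun j => Code.decode_eq_of_notMem_errorSet hA _ _
  have hfib : ∀ (A : Finset (Fin m)) (i : Fin m) d, _ := fun A i d =>
    card_restrict_fiber_mul_le (V := fun j => Fin (messageCard n (R i j)))
      (fun j => ∃ h : i ∈ A, j ∈ W.decoded A ⟨i, h⟩) d
  have key := chainProd_le_card_image (M := UserMessages W R n) c.encode
    (D := fun A i => (j : DecodedIndex W A i) → Fin (messageCard n (R i j)))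
    (fun A i x j => x j) (fun A i d => by convert hfib A i d)
    (fun A i y j => c.decode A y ⟨i, j.2.fst⟩ ⟨j, j.2.snd⟩) l hl
    (Finset.univ.biUnion c.errorSet)ᶜ (fun a t _ w hw => hgood _ a w hw)
    (by rw [compl_compl]; exact hS)
  have hY : ∀ s : Finset (Fin n → ZMod 2), s.card ≤ 2 ^ n := fun s => by
    simpa using Finset.card_le_univ s
  calc (2 : ℝ) ^ ((n : ℝ) * chainSum (extendRate r) l)
      ≤ _ := rpow_chainSum_le_chainProd
        (fun A i hi => rpow_extendRate_le_prod_messageCard hr n hi) l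
    _ ≤ ((2 ^ l.length * 2 ^ n : ℕ) : ℝ) := by
        exact_mod_cast key.trans (Nat.mul_le_mul_left _ (hY _))
    _ = _ := by push_cast; rfl

theorem chainSum_le_one_of_achievable {W : MessageStructure m} {r : RateTuple m}
    (h : Achievable W r) {l : List (Fin m)} (hl : l.Nodup) : chainSum (extendRate r) l ≤ 1 := by
  obtain ⟨R, -, hr, c, hc⟩ := h
  have h0 : ∀ A, Tendsto (fun n => (c n).errorProb A) atTop (𝓝 0) := by
    intro A
    -- Achievability says nothing about the empty state, but no message is decoded there.
    rcases A.eq_empty_or_nonempty with rfl | hA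
    · simp [Code.errorProb]
    · exact hc A hA
  have hsum : Tendsto (fun n => (∑ A, (c n).errorProb A) * 2 ^ l.length) atTop (𝓝 0) := by
    have := (tendsto_finsetSum Finset.univ fun A _ => h0 A).mul_const ((2 : ℝ) ^ l.length)
    simpa using this
  -- The factor 2 lost at each step costs only `l.length / n` in rate.
  have hev : ∀ᶠ n : ℕ in atTop,
      chainSum (extendRate r) l ≤ (l.length : ℝ) / (n : ℝ) + 1 := by
    filter_upwards [hsum.eventually (gt_mem_nhds one_pos), eventually_gt_atTop 0] with n hn hn0
    have h1 := rpow_chainSum_le_of_errorProb hr (c n) hl hn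
    rw [← pow_add, ← Real.rpow_natCast, Real.rpow_le_rpow_left_iff one_lt_two] at h1
    have hn' : (0 : ℝ) < n := by exact_mod_cast hn0
    push_cast at h1
    rw [div_add_one hn'.ne', le_div_iff₀ hn']
    linarith
  have hlim : Tendsto (fun n : ℕ => (l.length : ℝ) / (n : ℝ) + 1) atTop (𝓝 (0 + 1)) :=
    (tendsto_const_div_atTop_nhds_zero_nat _).add_const 1
  rw [zero_add] at hlim
  exact ge_of_tendsto hlim hev

/-- The rate tuples satisfying the outer bounds. -/
def outerRegion (m : ℕ) : Set (RateTuple m) :=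
  {r | (∀ A i, 0 ≤ extendRate r A i) ∧
    (∀ A B i, A ⊆ B → i ∈ A → extendRate r B i ≤ extendRate r A i) ∧
    ∀ l : List (Fin m), l.Nodup → chainSum (extendRate r) l ≤ 1}

theorem continuous_extendRate (A : Finset (Fin m)) (i : Fin m) :
    Continuous fun r : RateTuple m => extendRate r A i := by
  unfold extendRate
  split_ifs <;> fun_prop

theorem continuous_chainSum_extendRate (l : List (Fin m)) :
    Continuous fun r : RateTuple m => chainSum (extendRate r) l := by
  induction l with
  | nil => exact continuous_const
  | cons a t ih => exact (continuous_extendRate _ _).add ih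

theorem isClosed_outerRegion : IsClosed (outerRegion m) := by
  simp only [outerRegion, ofPred_and, ofPred_forall]
  refine (isClosed_iInter fun A => isClosed_iInter fun i =>
    isClosed_le continuous_const (continuous_extendRate A i)).inter
    ((isClosed_iInter fun A => isClosed_iInter fun B => isClosed_iInter fun i =>
      isClosed_iInter fun _ => isClosed_iInter fun _ =>
        isClosed_le (continuous_extendRate B i) (continuous_extendRate A i)).inter
    (isClosed_iInter fun l => isClosed_iInter fun _ =>
      isClosed_le (continuous_chainSum_extendRate l) continuous_const))

theorem mem_outerRegion_of_achievable {W : MessageStructure m} {r : RateTuple m}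
    (h : Achievable W r) : r ∈ outerRegion m := by
  refine ⟨?_, ?_, fun l hl => chainSum_le_one_of_achievable h hl⟩
  · obtain ⟨R, hR, hr, -⟩ := h
    intro A i
    rw [extendRate]
    split_ifs
    · rw [hr]; exact Finset.sum_nonneg fun j _ => hR _ j
    · exact le_rfl
  · obtain ⟨R, hR, hr, -⟩ := h
    intro A B i hAB hi
    rw [extendRate, extendRate, dif_pos (hAB hi), dif_pos hi, hr, hr]
    exact Finset.sum_le_sum_of_subset_of_nonneg (W.decoded_anti A B hAB ⟨i, hi⟩)
      fun j _ _ => hR _ j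

theorem capacityRegion_subset_outerRegion : capacityRegion m ⊆ outerRegion m :=
  closure_minimal (iUnion_subset fun _ => closure_minimal
    (fun _ h => mem_outerRegion_of_achievable h) isClosed_outerRegion) isClosed_outerRegion

/-! ### Averaging the chain bounds over all chains -/

section LevelAverage

variable {ι : Type*} [Fintype ι]

/-- The sum of `f A i` over all sets `A` of size `k` and all `i ∈ A`. -/
def levelSum (f : Finset ι → ι → ℝ) (k : ℕ) : ℝ :=
  ∑ B ∈ Finset.powersetCard k Finset.univ, ∑ i ∈ B, f B i

/-- The average of `f A i` over all sets `A` of size `k` and all `i ∈ A`. -/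
noncomputable def levelAverage (f : Finset ι → ι → ℝ) (k : ℕ) : ℝ :=
  levelSum f k / (k * (Fintype.card ι).choose k)

theorem levelSum_eq (f : Finset ι → ι → ℝ) (k : ℕ) :
    levelSum f k = k * (Fintype.card ι).choose k * levelAverage f k := by
  rcases Nat.eq_zero_or_pos k with rfl | hk
  · simp [levelSum]
  rcases lt_or_ge (Fintype.card ι) k with h | h
  · rw [levelSum, Finset.powersetCard_eq_empty.2 (by simpa using h), Nat.choose_eq_zero_of_lt h]
    simp
  · have h1 : (0 : ℝ) < (Fintype.card ι).choose k := by exact_mod_cast Nat.choose_pos h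
    have h2 : (0 : ℝ) < k := by exact_mod_cast hk
    rw [levelAverage]
    field_simp

theorem levelAverage_nonneg {f : Finset ι → ι → ℝ} (hf : ∀ A i, 0 ≤ f A i) (k : ℕ) :
    0 ≤ levelAverage f k :=
  div_nonneg (Finset.sum_nonneg fun _ _ => Finset.sum_nonneg fun _ _ => hf _ _) (by positivity)

end LevelAverage

section Averaging

variable {ι : Type*} [DecidableEq ι]

theorem chainSum_nonneg {f : Finset ι → ι → ℝ} (hf : ∀ A i, 0 ≤ f A i) (l : List ι) :
    0 ≤ chainSum f l := by
  induction l with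
  | nil => exact le_rfl
  | cons a t ih => exact add_nonneg (hf _ _) ih

/-- Any pair `i ∈ A` is the last step of some chain. The bound on single rates makes the capacity
region compact. -/
theorem le_of_chainSum_le {f : Finset ι → ι → ℝ} {c : ℝ} (hf : ∀ A i, 0 ≤ f A i)
    (hc : ∀ l : List ι, l.Nodup → chainSum f l ≤ c) {A : Finset ι} {i : ι} (hi : i ∈ A) :
    f A i ≤ c := by
  have h := hc (i :: (A.erase i).toList) (by simp [Finset.nodup_toList])
  rw [chainSum, Finset.toList_toFinset, Finset.insert_erase hi] at h
  linarith [chainSum_nonneg hf (A.erase i).toList]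

/-- The largest chain sum over all chains that build up the set `B`. -/
noncomputable def maxChainSum (f : Finset ι → ι → ℝ) (B : Finset ι) : ℝ :=
  ⨆ l : {l : List ι // l.Nodup ∧ l.toFinset = B}, chainSum f l

instance (B : Finset ι) : Nonempty {l : List ι // l.Nodup ∧ l.toFinset = B} :=
  ⟨⟨B.toList, B.nodup_toList, B.toList_toFinset⟩⟩

variable {f : Finset ι → ι → ℝ} {c : ℝ}

theorem maxChainSum_le (hc : ∀ l : List ι, l.Nodup → chainSum f l ≤ c) (B : Finset ι) :
    maxChainSum f B ≤ c :=
  ciSup_le fun l => hc _ l.2.1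

theorem chainSum_le_maxChainSum (hc : ∀ l : List ι, l.Nodup → chainSum f l ≤ c)
    {l : List ι} (hl : l.Nodup) :
    chainSum f l ≤ maxChainSum f l.toFinset :=
  le_ciSup (f := fun l' : {l' : List ι // l'.Nodup ∧ l'.toFinset = l.toFinset} => chainSum f l')
    ⟨c, forall_mem_range.2 fun l' => hc _ l'.2.1⟩ ⟨l, hl, rfl⟩

theorem add_maxChainSum_erase_le (hc : ∀ l : List ι, l.Nodup → chainSum f l ≤ c)
    {B : Finset ι} {i : ι} (hi : i ∈ B) :
    f B i + maxChainSum f (B.erase i) ≤ maxChainSum f B := by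
  rw [← le_sub_iff_add_le']
  refine ciSup_le fun ⟨l, hl, hlB⟩ => ?_
  have hil : i ∉ l := by
    rw [← List.mem_toFinset, hlB]; exact Finset.notMem_erase i B
  have h := chainSum_le_maxChainSum hc (List.nodup_cons.2 ⟨hil, hl⟩)
  rw [chainSum, List.toFinset_cons, hlB, Finset.insert_erase hi] at h
  linarith

variable [Fintype ι]

theorem sum_powersetCard_succ_erase (k : ℕ) (g : Finset ι → ι → ℝ) :
    ∑ B ∈ Finset.powersetCard (k + 1) Finset.univ, ∑ i ∈ B, g (B.erase i) i =
      ∑ B ∈ Finset.powersetCard k Finset.univ, ∑ i ∈ Bᶜ, g B i := by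
  rw [Finset.sum_sigma', Finset.sum_sigma']
  refine Finset.sum_bij' (fun x _ => ⟨x.1.erase x.2, x.2⟩) (fun x _ => ⟨insert x.2 x.1, x.2⟩)
    ?_ ?_ ?_ ?_ ?_
  · rintro ⟨B, i⟩ h
    simp only [Finset.mem_sigma, Finset.mem_powersetCard_univ] at h
    simp [Finset.card_erase_of_mem h.2, h.1]
  · rintro ⟨B, i⟩ h
    simp only [Finset.mem_sigma, Finset.mem_powersetCard_univ, Finset.mem_compl] at h
    simp [Finset.card_insert_of_notMem h.2, h.1]
  · rintro ⟨B, i⟩ h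
    simp only [Finset.mem_sigma] at h
    simp [Finset.insert_erase h.2]
  · rintro ⟨B, i⟩ h
    simp only [Finset.mem_sigma, Finset.mem_compl] at h
    simp [Finset.erase_insert h.2]
  · rintro ⟨B, i⟩ _
    rfl

/-- Each `f B i` with `B` of size `k + 1` is compared with `f (B.erase j) i` for the `k` indices `j
≠ i`, and the pairs are counted twice. -/
theorem levelAverage_succ_le (hf : ∀ A i, 0 ≤ f A i)
    (hanti : ∀ A B i, A ⊆ B → i ∈ A → f B i ≤ f A i) {k : ℕ} (hk : 1 ≤ k) :
    levelAverage f (k + 1) ≤ levelAverage f k := by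
  set n := Fintype.card ι with hn
  rcases le_or_gt n k with h | h
  · have : levelAverage f (k + 1) = 0 := by
      rw [levelAverage, ← hn, Nat.choose_eq_zero_of_lt (by omega)]; simp
    rw [this]
    exact levelAverage_nonneg hf k
  have key : (k : ℝ) * levelSum f (k + 1) ≤ ((n - k : ℕ) : ℝ) * levelSum f k := by
    have h1 : (k : ℝ) * levelSum f (k + 1) =
        ∑ B ∈ Finset.powersetCard (k + 1) Finset.univ, ∑ j ∈ B, ∑ i ∈ B.erase j, f B i := by
      rw [levelSum, Finset.mul_sum]
      refine Finset.sum_congr rfl fun B hB => ?_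
      rw [Finset.sum_congr rfl fun j hj => Finset.sum_erase_eq_sub hj, Finset.sum_sub_distrib,
        Finset.sum_const, Finset.mem_powersetCard_univ.1 hB, nsmul_eq_mul]
      push_cast
      ring
    have h2 : ((n - k : ℕ) : ℝ) * levelSum f k =
        ∑ B ∈ Finset.powersetCard (k + 1) Finset.univ, ∑ j ∈ B,
          ∑ i ∈ B.erase j, f (B.erase j) i := by
      rw [sum_powersetCard_succ_erase k fun B _ => ∑ i ∈ B, f B i, levelSum, Finset.mul_sum]
      refine Finset.sum_congr rfl fun B hB => ?_
      rw [Finset.sum_const, Finset.card_compl, Finset.mem_powersetCard_univ.1 hB, nsmul_eq_mul]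
    rw [h1, h2]
    exact Finset.sum_le_sum fun B _ => Finset.sum_le_sum fun j _ => Finset.sum_le_sum fun i hi =>
      hanti _ _ i (Finset.erase_subset j B) hi
  have hch : ((k : ℝ) + 1) * (n.choose (k + 1) : ℝ) = (n - k : ℕ) * n.choose k := by
    have := Nat.choose_succ_right_eq n k
    have h' : ((n.choose (k + 1) * (k + 1) : ℕ) : ℝ) = (n.choose k * (n - k) : ℕ) := by rw [this]
    push_cast at h'
    linarith
  have h1 : (0 : ℝ) < n.choose k := by exact_mod_cast Nat.choose_pos h.le
  have h2 : (0 : ℝ) < k := by exact_mod_cast hk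
  have h3 : (0 : ℝ) < (n - k : ℕ) := by exact_mod_cast (by omega : 0 < n - k)
  rw [levelAverage, levelAverage, ← hn]
  push_cast
  rw [hch, div_le_div_iff₀ (by positivity) (by positivity)]
  nlinarith

/-- Let `g k` be the average of `maxChainSum` over sets of size `k`. Averaging
`add_maxChainSum_erase_le` over `i ∈ B` and over `B` gives `g k + levelAverage f (k + 1) ≤ g (k +
1)`, so no sum over orderings is needed. -/
theorem sum_levelAverage_le (hc : ∀ l : List ι, l.Nodup → chainSum f l ≤ c)
    {k : ℕ} (hk : k ≤ Fintype.card ι) :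
    ∑ j ∈ Finset.range k, levelAverage f (j + 1) ≤ c := by
  set n := Fintype.card ι with hn
  let g : ℕ → ℝ := fun k =>
    (∑ B ∈ Finset.powersetCard k (Finset.univ : Finset ι), maxChainSum f B) / n.choose k
  have hchpos : ∀ k, k ≤ n → (0 : ℝ) < n.choose k := fun k hk => by
    exact_mod_cast Nat.choose_pos hk
  have hg1 : g k ≤ c := by
    rw [div_le_iff₀ (hchpos k hk)]
    have := Finset.sum_le_card_nsmul (Finset.powersetCard k (Finset.univ : Finset ι)) _ c
      fun B _ => maxChainSum_le hc B
    rw [Finset.card_powersetCard, Finset.card_univ, ← hn, nsmul_eq_mul] at this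
    linarith
  refine le_trans ?_ hg1
  clear hg1
  induction k with
  | zero =>
    have := chainSum_le_maxChainSum hc (l := []) List.nodup_nil
    simpa [g, chainSum] using this
  | succ k ih =>
    have hkn : k < n := hk
    rw [Finset.sum_range_succ]
    have step : ((k : ℝ) + 1) *
        ∑ B ∈ Finset.powersetCard (k + 1) (Finset.univ : Finset ι), maxChainSum f B ≥
        levelSum f (k + 1) + ((n - k : ℕ) : ℝ) *
          ∑ B ∈ Finset.powersetCard k (Finset.univ : Finset ι), maxChainSum f B := by
      have h2 : ((n - k : ℕ) : ℝ) *
          ∑ B ∈ Finset.powersetCard k (Finset.univ : Finset ι), maxChainSum f B =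
          ∑ B ∈ Finset.powersetCard (k + 1) Finset.univ, ∑ j ∈ B, maxChainSum f (B.erase j) := by
        rw [sum_powersetCard_succ_erase k fun B _ => maxChainSum f B, Finset.mul_sum]
        refine Finset.sum_congr rfl fun B hB => ?_
        rw [Finset.sum_const, Finset.card_compl, Finset.mem_powersetCard_univ.1 hB, nsmul_eq_mul]
      rw [h2, levelSum, ← Finset.sum_add_distrib, Finset.mul_sum]
      refine Finset.sum_le_sum fun B hB => ?_
      rw [← Finset.sum_add_distrib]
      have := Finset.sum_le_card_nsmul B (fun i => f B i + maxChainSum f (B.erase i)) _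
        fun i hi => add_maxChainSum_erase_le hc hi
      rw [Finset.mem_powersetCard_univ.1 hB, nsmul_eq_mul] at this
      push_cast at this
      exact this
    have hch : ((k : ℝ) + 1) * (n.choose (k + 1) : ℝ) = (n - k : ℕ) * n.choose k := by
      have := Nat.choose_succ_right_eq n k
      have h' : ((n.choose (k + 1) * (k + 1) : ℕ) : ℝ) = (n.choose k * (n - k) : ℕ) := by
        rw [this]
      push_cast at h'
      linarith
    have h1 := hchpos k hkn.le
    have h2 := hchpos (k + 1) hkn
    have h3 : (0 : ℝ) < (n - k : ℕ) := by exact_mod_cast (by omega : 0 < n - k)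
    have hk1 : (0 : ℝ) < (k : ℝ) + 1 := by positivity
    calc ∑ j ∈ Finset.range k, levelAverage f (j + 1) + levelAverage f (k + 1)
        ≤ g k + levelAverage f (k + 1) := by gcongr; exact ih hkn.le
      _ = (((n - k : ℕ) : ℝ) *
          (∑ B ∈ Finset.powersetCard k (Finset.univ : Finset ι), maxChainSum f B) +
            levelSum f (k + 1)) / (((k : ℝ) + 1) * n.choose (k + 1)) := by
          rw [add_div, levelAverage, ← hn]
          push_cast
          congr 1
          rw [hch]
          simp only [g]
          field_simp
      _ ≤ g (k + 1) := by
          simp only [g]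
          rw [div_le_div_iff₀ (by positivity) h2]
          nlinarith

end Averaging

/-! ### The largest expected sum-rate -/

/-- Abel summation: nonnegative partial sums stay nonnegative under nonincreasing nonnegative
weights. -/
theorem sum_mul_nonneg_of_antitone {d a : ℕ → ℝ} {n : ℕ} (ha0 : ∀ j, 0 ≤ a j)
    (ha : ∀ j, a (j + 1) ≤ a j) (hd : ∀ k ≤ n, 0 ≤ ∑ j ∈ Finset.range k, d j) :
    0 ≤ ∑ j ∈ Finset.range n, d j * a j := by
  have key : ∀ k ≤ n, a k * ∑ j ∈ Finset.range k, d j ≤ ∑ j ∈ Finset.range k, d j * a j := by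
    intro k hk
    induction k with
    | zero => simp
    | succ k ih =>
      have h1 := ih (by omega)
      have h2 := mul_le_mul_of_nonneg_right (ha k) (hd _ hk)
      rw [Finset.sum_range_succ] at h2 ⊢
      rw [Finset.sum_range_succ]
      linarith
  exact (mul_nonneg (ha0 n) (hd n le_rfl)).trans (key n le_rfl)

/-- The probability that exactly `j` of `m` users are active. -/
noncomputable def activeProb (m : ℕ) (p : ℝ) (j : ℕ) : ℝ :=
  m.choose j * p ^ j * (1 - p) ^ (m - j)

/-- The expected sum-rate of a single message per user encoded at rate `1 / k`, decoded when at
most `k` users are active. -/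
noncomputable def singleRate (m : ℕ) (p : ℝ) (k : ℕ) : ℝ :=
  (∑ j ∈ Finset.range k, ((j : ℝ) + 1) * activeProb m p (j + 1)) / k

theorem expectedSumRate_eq (p : ℝ) (r : RateTuple m) :
    expectedSumRate m p r = ∑ j ∈ Finset.range m,
      ((j : ℝ) + 1) * activeProb m p (j + 1) * levelAverage (extendRate r) (j + 1) := by
  have h1 : expectedSumRate m p r =
      ∑ j ∈ Finset.range (m + 1), p ^ j * (1 - p) ^ (m - j) * levelSum (extendRate r) j := by
    rw [expectedSumRate, ← Finset.powerset_univ, Finset.sum_powerset, Finset.card_univ,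
      Fintype.card_fin]
    refine Finset.sum_congr rfl fun j _ => ?_
    rw [levelSum, Finset.mul_sum]
    refine Finset.sum_congr rfl fun A hA => ?_
    rw [Finset.mem_powersetCard_univ.1 hA, ← Finset.sum_coe_sort A]
    congr 1
    exact Finset.sum_congr rfl fun i _ => by rw [extendRate, dif_pos i.2]
  rw [h1, Finset.sum_range_succ']
  have h0 : levelSum (extendRate r) 0 = 0 := by simp [levelSum]
  rw [h0, mul_zero, add_zero]
  refine Finset.sum_congr rfl fun j _ => ?_
  rw [levelSum_eq, activeProb, Fintype.card_fin]
  push_cast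
  ring

/-- With `d j = c - (j + 1) * activeProb m p (j + 1)`, the hypothesis `singleRate m p k ≤ c` says
that the `k`-th partial sum of `d` is nonnegative. -/
theorem expectedSumRate_le {p : ℝ} {r : RateTuple m} (hr : r ∈ outerRegion m) {c : ℝ}
    (hc0 : 0 ≤ c) (hc : ∀ k, 1 ≤ k → k ≤ m → singleRate m p k ≤ c) :
    expectedSumRate m p r ≤ c := by
  obtain ⟨h0, hanti, hchain⟩ := hr
  rw [expectedSumRate_eq]
  have h1 := sum_mul_nonneg_of_antitone (n := m)
    (d := fun j => c - ((j : ℝ) + 1) * activeProb m p (j + 1))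
    (fun j => levelAverage_nonneg h0 (j + 1))
    (fun j => levelAverage_succ_le h0 hanti (Nat.le_add_left 1 j)) (by
      intro k hk
      rw [Finset.sum_sub_distrib, Finset.sum_const, Finset.card_range, nsmul_eq_mul, sub_nonneg]
      rcases Nat.eq_zero_or_pos k with rfl | hk0
      · simp
      · have := hc k hk0 hk
        rw [singleRate, div_le_iff₀ (by exact_mod_cast hk0)] at this
        linarith)
  have h2 := sum_levelAverage_le hchain (k := m) (by simp)
  simp_rw [sub_mul] at h1
  rw [Finset.sum_sub_distrib, ← Finset.mul_sum] at h1
  nlinarith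

theorem activeProb_eq_zero {p : ℝ} {j : ℕ} (h : m < j) : activeProb m p j = 0 := by
  simp [activeProb, Nat.choose_eq_zero_of_lt h]

theorem expectedSumRate_singleMessageTuple (p : ℝ) (k : ℕ) :
    expectedSumRate m p (singleMessageTuple m k) = singleRate m p k := by
  have hlevel : ∀ j, j + 1 ≤ m → levelAverage (extendRate (singleMessageTuple m k)) (j + 1) =
      if j < k then 1 / (k : ℝ) else 0 := by
    intro j hj
    have h1 : levelSum (extendRate (singleMessageTuple m k)) (j + 1) =
        ((j + 1 : ℕ) : ℝ) * m.choose (j + 1) * if j < k then 1 / (k : ℝ) else 0 := by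
      rw [levelSum, Finset.sum_congr rfl (g := fun _ => ((j + 1 : ℕ) : ℝ) *
        if j < k then 1 / (k : ℝ) else 0), Finset.sum_const, Finset.card_powersetCard,
        Finset.card_univ, Fintype.card_fin, nsmul_eq_mul]
      · ring
      · intro B hB
        have hB' := Finset.mem_powersetCard_univ.1 hB
        rw [Finset.sum_congr rfl (g := fun _ => if j < k then 1 / (k : ℝ) else 0),
          Finset.sum_const, hB', nsmul_eq_mul]
        intro i hi
        rw [extendRate, dif_pos hi, singleMessageTuple, hB']
        rfl
    have h2 : (0 : ℝ) < m.choose (j + 1) := by exact_mod_cast Nat.choose_pos hj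
    rw [levelAverage, h1, Fintype.card_fin, mul_div_cancel_left₀]
    positivity
  rw [expectedSumRate_eq, Finset.sum_congr rfl fun j hj => by
    rw [hlevel j (Finset.mem_range.1 hj)], singleRate, Finset.sum_div]
  simp only [mul_ite, mul_zero, mul_one_div]
  rw [← Finset.sum_filter]
  refine Finset.sum_subset_zero_on_sdiff (fun j hj => ?_) (fun j hj => ?_) fun _ _ => rfl
  · simp only [Finset.mem_filter] at hj
    exact Finset.mem_range.2 hj.2
  · simp only [Finset.mem_sdiff, Finset.mem_filter, Finset.mem_range, not_and] at hj
    rw [activeProb_eq_zero (by by_contra h; exact hj.2 (by omega) hj.1)]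
    simp

theorem isCompact_capacityRegion (m : ℕ) : IsCompact (capacityRegion m) := by
  refine IsCompact.of_isClosed_subset (isCompact_Icc (a := (0 : RateTuple m)) (b := 1))
    isClosed_closure fun r hr => ?_
  obtain ⟨h0, -, h1⟩ := capacityRegion_subset_outerRegion hr
  have hext : ∀ (A : Finset (Fin m)) (i : A), extendRate r A i = r A i := fun A i => by
    rw [extendRate, dif_pos i.2]
  exact ⟨fun A i => (h0 A i).trans_eq (hext A i),
    fun A i => (hext A i).symm.trans_le (le_of_chainSum_le h0 h1 i.2)⟩

theorem continuous_expectedSumRate (m : ℕ) (p : ℝ) : Continuous (expectedSumRate m p) := by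
  unfold expectedSumRate
  fun_prop

theorem isGreatest_throughput {p : ℝ} (hne : (capacityRegion m).Nonempty) :
    IsGreatest (expectedSumRate m p '' capacityRegion m) (throughput m p) :=
  ((isCompact_capacityRegion m).image (continuous_expectedSumRate m p)).isGreatest_sSup
    (hne.image _)

/-! ### Achievability: zero-error codes from Vandermonde matrices -/

theorem eq_of_sum_mul_pow_eq {K ι : Type*} [Field K] {α : ι → K} (hα : Function.Injective α)
    {A : Finset ι} {k : ℕ} (hA : A.card ≤ k) {x y : ι → K}
    (h : ∀ s : Fin k, ∑ i ∈ A, x i * α i ^ (s : ℕ) = ∑ i ∈ A, y i * α i ^ (s : ℕ)) :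
    ∀ i ∈ A, x i = y i := by
  let e := A.equivFin
  have h0 := Matrix.eq_zero_of_forall_pow_sum_mul_pow_eq_zero
    (f := fun j => α (e.symm j)) (v := fun j => x (e.symm j) - y (e.symm j))
    (hα.comp (Subtype.val_injective.comp e.symm.injective)) (fun s => by
      have hs := h ⟨s, s.2.trans_le hA⟩
      rw [← Finset.sum_coe_sort A, ← Finset.sum_coe_sort A, ← sub_eq_zero,
        ← Finset.sum_sub_distrib, ← e.symm.sum_comp] at hs
      simpa [sub_mul] using hs)
  intro i hi
  have := congrFun h0 (e ⟨i, hi⟩)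
  simpa [sub_eq_zero] using this

/-- Encoders for which the sum of at most `k` codewords determines the messages. -/
theorem exists_encoders {k L n N : ℕ} (hL : L ≠ 0) (hkL : k * L ≤ n) (hm : m ≤ 2 ^ L)
    (hN : N ≤ 2 ^ L) :
    ∃ enc : Fin m → Fin N → (Fin n → ZMod 2), ∀ A : Finset (Fin m), A.card ≤ k →
      ∀ x y : Fin m → Fin N, ∑ i ∈ A, enc i (x i) = ∑ i ∈ A, enc i (y i) →
        ∀ i ∈ A, x i = y i := by
  have : Fintype (GaloisField 2 L) := Fintype.ofFinite _
  have hcard : Fintype.card (GaloisField 2 L) = 2 ^ L := by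
    rw [← Nat.card_eq_fintype_card, GaloisField.card 2 L hL]
  obtain ⟨α⟩ := Function.Embedding.nonempty_of_card_le
    (α := Fin m) (β := GaloisField 2 L) (by simpa [hcard] using hm)
  obtain ⟨μ⟩ := Function.Embedding.nonempty_of_card_le
    (α := Fin N) (β := GaloisField 2 L) (by simpa [hcard] using hN)
  -- `k` symbols of `GF(2^L)` are `k * L` bits. Linearity of `τ` over `GF(2)` makes the channel sum
  -- of codewords the image of the sum of symbol vectors.
  obtain ⟨τ, hτ⟩ : ∃ τ : (Fin k → GaloisField 2 L) →ₗ[ZMod 2] (Fin n → ZMod 2),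
      Function.Injective τ := by
    have : Module.finrank (ZMod 2) (Fin k → GaloisField 2 L) ≤
        Module.finrank (ZMod 2) (Fin n → ZMod 2) := by
      rw [Module.finrank_pi_fintype]
      simpa [GaloisField.finrank 2 hL] using hkL
    exact finrank_le_iff_exists_linearMap.1 this
  refine ⟨fun i x => τ fun s => μ x * α i ^ (s : ℕ), fun A hA x y h i hi => μ.injective ?_⟩
  rw [← map_sum, ← map_sum] at h
  refine eq_of_sum_mul_pow_eq (x := fun i => μ (x i)) (y := fun i => μ (y i)) α.injective hA
    (fun s => ?_) i hi
  simpa using congrFun (hτ h) s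

theorem exists_code_errorProb_eq_zero {k L n : ℕ} {ρ : ℝ} (hL : L ≠ 0) (hkL : k * L ≤ n)
    (hm : m ≤ 2 ^ L) (hN : messageCard n ρ ≤ 2 ^ L) :
    ∃ c : Code (singleMessage m k) (fun _ _ => ρ) n, ∀ A, c.errorProb A = 0 := by
  classical
  obtain ⟨enc, henc⟩ := exists_encoders hL hkL hm hN
  let out : Finset (Fin m) → (Fin m → Fin (messageCard n ρ)) → (Fin n → ZMod 2) :=
    fun A x => ∑ i ∈ A, enc i (x i)
  let c : Code (singleMessage m k) (fun _ _ => ρ) n :=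
    { encode := fun i x => enc i (x (0 : Fin 1))
      decode := fun A y i _ =>
        if h : ∃ x, out A x = y then h.choose i else ⟨0, messageCard_pos n ρ⟩ }
  refine ⟨c, fun A => ?_⟩
  rw [Code.errorProb_eq, div_eq_zero_iff]
  left
  rw [Nat.cast_eq_zero, Finset.card_eq_zero, Finset.eq_empty_iff_forall_notMem]
  intro w hw
  obtain ⟨-, i, ⟨j, hj⟩, hne⟩ := Finset.mem_filter.1 hw
  have hA : A.card ≤ k := by
    by_contra hA
    simp only [singleMessage, hA, if_false] at hj
    exact absurd hj (Finset.notMem_empty j)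
  have hex : ∃ x, out A x = c.output A w := ⟨fun i => w i (0 : Fin 1), rfl⟩
  refine hne ?_
  have hj0 : j = (0 : Fin 1) := Subsingleton.elim (α := Fin 1) _ _
  subst hj0
  show (if h : ∃ x, out A x = c.output A w then h.choose i else ⟨0, messageCard_pos n ρ⟩) = _
  rw [dif_pos hex]
  exact henc A hA hex.choose (fun i => w i (0 : Fin 1)) hex.choose_spec i i.2

theorem nonempty_code {W : MessageStructure m} (R : W.Rates) (n : ℕ) : Nonempty (Code W R n) :=
  ⟨⟨fun _ _ => 0, fun _ _ _ _ => ⟨0, messageCard_pos _ _⟩⟩⟩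

/-- The finitely many short block lengths are filled with arbitrary codes. -/
theorem achievable_of_eventually_errorProb_eq_zero {W : MessageStructure m} {r : RateTuple m}
    (R : W.Rates) (hR : ∀ i j, 0 ≤ R i j)
    (hr : ∀ (A : Finset (Fin m)) (i : A), r A i = ∑ j ∈ W.decoded A i, R i j)
    (h : ∀ᶠ n : ℕ in atTop, ∃ c : Code W R n, ∀ A, c.errorProb A = 0) : Achievable W r := by
  have hc : ∀ n : ℕ, ∃ c : Code W R n,
      (∃ c : Code W R n, ∀ A, c.errorProb A = 0) → ∀ A, c.errorProb A = 0 := by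
    intro n
    by_cases hn : ∃ c : Code W R n, ∀ A, c.errorProb A = 0
    · exact hn.imp fun c hc _ => hc
    · exact ⟨(nonempty_code R n).some, fun h => absurd h hn⟩
  choose c hc using hc
  refine ⟨R, hR, hr, c, fun A _ => tendsto_const_nhds.congr' ?_⟩
  filter_upwards [h] with n hn
  exact (hc n hn A).symm

theorem achievable_singleMessage {k : ℕ} (hk : 1 ≤ k) {ρ : ℝ} (h0 : 0 ≤ ρ) (hρ : ρ < 1 / (k : ℝ)) :
    Achievable (singleMessage m k) fun A _ => if A.card ≤ k then ρ else 0 := by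
  have hk0 : (0 : ℝ) < k := by exact_mod_cast hk
  refine achievable_of_eventually_errorProb_eq_zero (fun _ _ => ρ) (fun _ _ => h0) ?_ ?_
  · intro A i
    by_cases hA : A.card ≤ k
    · simp [singleMessage, hA]
    · simp [singleMessage, hA]
  · have hdiv : Tendsto (fun n : ℕ => n / k) atTop atTop :=
      Nat.tendsto_div_const_atTop (by omega)
    have hpow : Tendsto (fun n : ℕ => 2 ^ (n / k)) atTop atTop :=
      (tendsto_pow_atTop_atTop_of_one_lt one_lt_two).comp hdiv
    -- The slack `n * (1/k - ρ) ≥ 1` absorbs the rounding in `L = n / k`.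
    have hlin : Tendsto (fun n : ℕ => (n : ℝ) * (1 / (k : ℝ) - ρ)) atTop atTop :=
      tendsto_natCast_atTop_atTop.atTop_mul_const (sub_pos.2 hρ)
    filter_upwards [hdiv.eventually_ge_atTop 1, hpow.eventually_ge_atTop m,
      hlin.eventually_ge_atTop 1] with n h1 h2 h3
    refine exists_code_errorProb_eq_zero (L := n / k) (by omega) (Nat.mul_div_le n k) h2 ?_
    refine Nat.ceil_le.2 ?_
    push_cast
    rw [← Real.rpow_natCast]
    refine Real.rpow_le_rpow_of_exponent_le one_le_two ?_
    have h4 : (n : ℝ) / k < (n / k : ℕ) + 1 := by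
      rw [div_lt_iff₀ hk0]
      exact_mod_cast Nat.lt_mul_of_div_lt (Nat.lt_succ_self _) hk
    rw [mul_sub, mul_one_div] at h3
    linarith

/-- Rate exactly `1/k` is reached as a limit of rates `ρ < 1/k`, through the closure in the
definition. -/
theorem singleMessageTuple_mem_capacityRegionOf {k : ℕ} (hk : 1 ≤ k) :
    singleMessageTuple m k ∈ capacityRegionOf (singleMessage m k) := by
  have hk0 : (0 : ℝ) < 1 / (k : ℝ) := by
    have : (0 : ℝ) < k := by exact_mod_cast hk
    positivity
  have hcont : Continuous fun ρ : ℝ =>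
      (fun A _ => if A.card ≤ k then ρ else 0 : RateTuple m) := by
    refine continuous_pi fun A => continuous_pi fun _ => ?_
    split_ifs <;> fun_prop
  have hmem : 1 / (k : ℝ) ∈ closure (Ico 0 (1 / (k : ℝ))) := by
    rw [closure_Ico hk0.ne]
    exact ⟨hk0.le, le_rfl⟩
  have hmaps : MapsTo (fun ρ : ℝ => (fun A _ => if A.card ≤ k then ρ else 0 : RateTuple m))
      (Ico 0 (1 / (k : ℝ))) {r | Achievable (singleMessage m k) r} :=
    fun ρ hρ => achievable_singleMessage hk hρ.1 hρ.2
  exact hmaps.closure hcont hmem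

theorem singleMessageTuple_mem_capacityRegion {k : ℕ} (hk : 1 ≤ k) :
    singleMessageTuple m k ∈ capacityRegion m :=
  subset_closure (mem_iUnion.2 ⟨_, singleMessageTuple_mem_capacityRegionOf hk⟩)

theorem isGreatest_image_expectedSumRate (m : ℕ) (p : ℝ) :
    IsGreatest (expectedSumRate m p '' capacityRegion m) (throughput m p) :=
  isGreatest_throughput ⟨_, singleMessageTuple_mem_capacityRegion le_rfl⟩

theorem singleRate_le_throughput (m : ℕ) (p : ℝ) {k : ℕ} (hk : 1 ≤ k) :
    singleRate m p k ≤ throughput m p := by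
  rw [← expectedSumRate_singleMessageTuple]
  exact (isGreatest_image_expectedSumRate m p).2
    (mem_image_of_mem _ (singleMessageTuple_mem_capacityRegion hk))

theorem throughput_le {p c : ℝ} (hc0 : 0 ≤ c)
    (hc : ∀ k, 1 ≤ k → k ≤ m → singleRate m p k ≤ c) : throughput m p ≤ c := by
  obtain ⟨r, hr, hrp⟩ := (isGreatest_image_expectedSumRate m p).1
  rw [← hrp]
  exact expectedSumRate_le (capacityRegion_subset_outerRegion hr) hc0 hc

/-! ### The Poisson limit -/

theorem tendsto_singleRate (lam : ℝ) (k : ℕ) :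
    Tendsto (fun m : ℕ => singleRate m (lam / m) k) atTop (𝓝 (poissonRate k lam)) := by
  have hlam : Tendsto (fun m : ℕ => (m : ℝ) * (lam / m)) atTop (𝓝 lam) := by
    refine tendsto_const_nhds.congr' ?_
    filter_upwards [eventually_gt_atTop 0] with m hm
    have : (m : ℝ) ≠ 0 := by positivity
    field_simp
  have h : Tendsto (fun m : ℕ => singleRate m (lam / m) k) atTop
      (𝓝 ((∑ j ∈ Finset.range k,
        ((j : ℝ) + 1) * (Real.exp (-lam) * lam ^ (j + 1) / ((j + 1)! : ℝ))) / k)) :=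
    (tendsto_finsetSum _ fun j _ =>
      (ProbabilityTheory.tendsto_choose_mul_pow_of_tendsto_mul_atTop (j + 1)
        hlam).const_mul _).div_const _
  convert h using 2
  rw [poissonRate, expSum, Finset.mul_sum, Finset.mul_sum, Finset.sum_div]
  refine Finset.sum_congr rfl fun j _ => ?_
  have := pow_succ_div_factorial_succ j lam
  calc lam / k * (Real.exp (-lam) * (lam ^ j / (j ! : ℝ)))
      = Real.exp (-lam) * (lam * (lam ^ j / (j ! : ℝ))) / k := by ring
    _ = _ := by rw [← this]; ring

/-- The numerator is part of the expected number `m * p` of active users. -/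
theorem singleRate_le_div {p : ℝ} (hp0 : 0 ≤ p) (hp1 : p ≤ 1) (k : ℕ) :
    singleRate m p k ≤ m * p / k := by
  have hq : 0 ≤ 1 - p := sub_nonneg.2 hp1
  rw [singleRate]
  gcongr
  rcases m with _ | n
  · refine (Finset.sum_nonpos fun j _ => ?_).trans (by simp)
    rw [activeProb_eq_zero (Nat.succ_pos j), mul_zero]
  have hterm : ∀ j : ℕ, ((j : ℝ) + 1) * activeProb (n + 1) p (j + 1) =
      (n + 1 : ℕ) * p * (n.choose j * p ^ j * (1 - p) ^ (n - j)) := by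
    intro j
    have h : ((n + 1 : ℕ) * n.choose j : ℝ) = (n + 1).choose (j + 1) * (j + 1) := by
      exact_mod_cast Nat.add_one_mul_choose_eq n j
    rw [activeProb, Nat.add_sub_add_right]
    linear_combination (-(p ^ (j + 1) * (1 - p) ^ (n - j))) * h
  rw [Finset.sum_congr rfl fun j _ => hterm j, ← Finset.mul_sum]
  refine mul_le_of_le_one_right (by positivity) ?_
  have hone : ∑ j ∈ Finset.range (n + 1), (n.choose j * p ^ j * (1 - p) ^ (n - j) : ℝ) = 1 := by
    have := add_pow p (1 - p) n
    rw [add_sub_cancel, one_pow] at this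
    exact (Finset.sum_congr rfl fun j _ => by ring).trans this.symm
  have hnonneg : ∀ j : ℕ, 0 ≤ n.choose j * p ^ j * (1 - p) ^ (n - j) := fun j =>
    mul_nonneg (by positivity) (pow_nonneg hq _)
  calc ∑ j ∈ Finset.range k, (n.choose j * p ^ j * (1 - p) ^ (n - j) : ℝ)
      ≤ ∑ j ∈ Finset.range (max k (n + 1)), (n.choose j * p ^ j * (1 - p) ^ (n - j) : ℝ) :=
        Finset.sum_le_sum_of_subset_of_nonneg (Finset.range_mono (le_max_left k (n + 1)))
          fun j _ _ => hnonneg j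
    _ = ∑ j ∈ Finset.range (n + 1), (n.choose j * p ^ j * (1 - p) ^ (n - j) : ℝ) :=
        (Finset.sum_subset (Finset.range_mono (le_max_right k (n + 1))) fun j _ hj => by
          rw [Nat.choose_eq_zero_of_lt (by simpa using hj)]; simp).symm
    _ = 1 := hone

theorem tendsto_throughput {lam : ℝ} (hlam : 0 < lam) :
    Tendsto (fun m : ℕ => throughput m (lam / m)) atTop (𝓝 (poissonThroughput lam)) := by
  refine tendsto_order.2 ⟨fun a ha => ?_, fun a ha => ?_⟩
  · obtain ⟨k, hk, hmem⟩ := exists_mem_Ioc_breakpoint hlam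
    rw [poissonThroughput_eq hk hmem] at ha
    filter_upwards [(tendsto_singleRate lam k).eventually (lt_mem_nhds ha)] with m hm
    exact hm.trans_le (singleRate_le_throughput m _ hk)
  · obtain ⟨b, hb, hba⟩ := exists_between ha
    have hb0 : 0 < b := (poissonThroughput_pos hlam).trans hb
    -- For `k > K` the bound `lam / k < b` holds uniformly in `m`. Only finitely many `k` are left
    -- to the pointwise limits.
    obtain ⟨K, hK⟩ := exists_nat_gt (lam / b)
    have hsmall : ∀ᶠ m : ℕ in atTop, ∀ k ∈ Finset.Icc 1 K, singleRate m (lam / m) k < b :=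
      (Finset.eventually_all _).2 fun k hk => (tendsto_singleRate lam k).eventually
        (gt_mem_nhds ((poissonRate_le_poissonThroughput (Finset.mem_Icc.1 hk).1 hlam).trans_lt hb))
    filter_upwards [hsmall, eventually_gt_atTop 0,
      tendsto_natCast_atTop_atTop.eventually_ge_atTop lam] with m hm hm0 hmlam
    refine (throughput_le hb0.le fun k hk _ => ?_).trans_lt hba
    rcases le_or_gt k K with hkK | hkK
    · exact (hm k (Finset.mem_Icc.2 ⟨hk, hkK⟩)).le
    · have hm' : (0 : ℝ) < m := by exact_mod_cast hm0
      refine (singleRate_le_div (by positivity) ((div_le_one hm').2 hmlam) k).trans ?_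
      rw [mul_div_cancel₀ _ hm'.ne', div_le_iff₀ (by exact_mod_cast hk)]
      rw [div_lt_iff₀ hb0] at hK
      have : (K : ℝ) ≤ k := by exact_mod_cast hkK.le
      nlinarith

end RandomAccess

/-! ### Assembly of the theorem -/

theorem mainTheorem11 :
    -- the maximum that defines the throughput is attained
    (∀ m : ℕ, 2 ≤ m → ∀ p ∈ Icc (0 : ℝ) 1,
      IsGreatest (RandomAccess.expectedSumRate m p '' RandomAccess.capacityRegion m)
        (RandomAccess.throughput m p)) ∧
    ∃ (brk : ℕ → ℝ) (T : ℝ → ℝ),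
      -- `brk k` is the unique positive root of the `k`-th equation
      brk 0 = 0 ∧
      (∀ k : ℕ, 1 ≤ k →
        0 < brk k ∧
        1 / ((k : ℝ) + 1) * RandomAccess.incompleteGamma ((k : ℝ) + 1) (brk k) =
          RandomAccess.incompleteGamma (k : ℝ) (brk k) ∧
        ∀ x : ℝ, 0 < x →
          1 / ((k : ℝ) + 1) * RandomAccess.incompleteGamma ((k : ℝ) + 1) x =
            RandomAccess.incompleteGamma (k : ℝ) x →
          x = brk k) ∧
      -- the intervals `(brk (k - 1), brk k]` partition `(0, ∞)`
      StrictMono brk ∧ Tendsto brk atTop atTop ∧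
      -- `T` is the limit of the throughput
      (∀ lam : ℝ, 0 < lam →
        Tendsto (fun m : ℕ => RandomAccess.throughput m (lam / (m : ℝ))) atTop (𝓝 (T lam))) ∧
      (∀ k : ℕ, 1 ≤ k → ∀ lam ∈ Ioc (brk (k - 1)) (brk k),
        T lam = lam / (k ! : ℝ) * RandomAccess.incompleteGamma (k : ℝ) lam) ∧
      -- the throughput is attained by a single message per user, encoded at rate `1 / k`
      (∀ k : ℕ, 1 ≤ k →
        (∀ m : ℕ, 2 ≤ m → RandomAccess.singleMessageTuple m k ∈
          RandomAccess.capacityRegionOf (RandomAccess.singleMessage m k)) ∧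
        ∀ lam ∈ Ioc (brk (k - 1)) (brk k),
          Tendsto (fun m : ℕ => RandomAccess.expectedSumRate m (lam / (m : ℝ))
            (RandomAccess.singleMessageTuple m k)) atTop (𝓝 (T lam))) ∧
      ContinuousOn T (Ioi 0) ∧
      (∀ k : ℕ, 1 ≤ k →
        ConcaveOn ℝ (Ioc (brk (k - 1)) (brk k)) T ∧
        StrictMonoOn T (Ioc (brk (k - 1)) (brk k))) ∧
      Tendsto T atTop (𝓝 1) := by
  refine ⟨fun m _ p _ => RandomAccess.isGreatest_image_expectedSumRate m p,
    RandomAccess.breakpoint, RandomAccess.poissonThroughput, RandomAccess.breakpoint_zero,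
    fun k hk => ?_, RandomAccess.strictMono_breakpoint, RandomAccess.tendsto_breakpoint,
    fun lam hlam => RandomAccess.tendsto_throughput hlam, fun k hk lam hlam => ?_,
    fun k hk => ⟨fun m _ => RandomAccess.singleMessageTuple_mem_capacityRegionOf hk,
      fun lam hlam => ?_⟩,
    RandomAccess.continuousOn_poissonThroughput, fun k hk => ?_,
    RandomAccess.tendsto_poissonThroughput⟩
  · obtain ⟨h1, -, h3⟩ := RandomAccess.breakpoint_spec hk
    exact ⟨h1, (RandomAccess.incompleteGamma_eq_iff hk h1).2 h3, fun x hx h =>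
      RandomAccess.eq_breakpoint hk hx ((RandomAccess.incompleteGamma_eq_iff hk hx).1 h)⟩
  · rw [RandomAccess.poissonThroughput_eq hk hlam, RandomAccess.poissonRate_eq_incompleteGamma hk
      ((RandomAccess.breakpoint_nonneg _).trans_lt hlam.1)]
  · simp_rw [RandomAccess.expectedSumRate_singleMessageTuple]
    rw [RandomAccess.poissonThroughput_eq hk hlam]
    exact RandomAccess.tendsto_singleRate lam k
  · have heq : EqOn (RandomAccess.poissonRate k) RandomAccess.poissonThroughput
        (Ioc (RandomAccess.breakpoint (k - 1)) (RandomAccess.breakpoint k)) :=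
      fun x hx => (RandomAccess.poissonThroughput_eq hk hx).symm
    exact ⟨(RandomAccess.concaveOn_poissonRate hk).congr heq,
      (RandomAccess.strictMonoOn_poissonRate hk).congr heq⟩
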